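/- A \emph{lattice graph} is a finite, non-empty oriented graph $\Lambda=(\Lambda^0,\Lambda^1)$ with source and target maps $s,t\colon\Lambda^1\to\Lambda^0$, with at most one edge between any two vertices, without loops, and connected as an unoriented graph. Let $\mathsf C_\Lambda$ be the category of oriented paths in $\Lambda$. A \emph{refinement} $\iota\colon\Lambda_i\to\Lambda_j$ is a functor $\mathsf C_{\Lambda_i}\to\mathsf C_{\Lambda_j}$ that is injective on vertices, maps every edge to a path of positive length, and maps distinct edges to paths without common edges. Lattice graphs and refinements form a category. Let $G$ be a compact Hausdorff topological group (for example a compact Lie group), let $I$ be a non-empty directed set, and let $(\Lambda_i,\iota_{i,j})_{i\le j\in I}$ be a direct system of lattice graphs and refinements. Put $X_i=G^{\Lambda_i^1}$ with its normalized Haar measure $\mu_i$, and for $i\le j$ let $R_{i,j}\colon X_j\to X_i$, $R_{i,j}(a)_e=a_{e_1}\cdots a_{e_n}$, where $\iota_{i,j}(e)=(e_1,\dots,e_n)$. The gauge group $\mathcal G_i=G^{\Lambda_i^0}$ acts on $X_i$ by $(g\cdot a)_e=g_{s(e)}a_eg_{t(e)}^{-1}$. Let $X_i^{\rm red}=\mathcal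 G_i\backslash X_i$ be the compact Hausdorff quotient with the image $\mu_i^{\rm red}$ of $\mu_i$ and the induced maps $R_{i,j}^{\rm red}$. The maps $R_{i,j}$ and $R^{\rm red}_{i,j}$ preserve the measures, so that $u_{i,j}\psi=\psi\circ R_{i,j}$ is an isometry of $L^2(X_i,\mu_i)$ into $L^2(X_j,\mu_j)$, and the algebras of compact operators $B_0(L^2(X_i,\mu_i))$ form a direct system of C*-algebras with the connecting maps $b\mapsto u_{i,j}\,b\,u_{i,j}^*$; likewise in the reduced case. Let $(X_i,\mu_i,R_{i,j})$ stand either for this system or for the reduced system $(X_i^{\rm red},\mu_i^{\rm red},R_{i,j}^{\rm red})$. Let $X_\infty=\varprojlim X_i$ be the inverse limit of topological spaces, with projections $R_{i,\infty}\colon X_\infty\to X_i$, and let $A_\infty=\varinjlim B_0(L^2(X_i,\mu_i))$ be the direct limit of C*-algebras. Then there is exactly one Radon measure $\mu$ on $X_\infty$ with $(R_{i,\infty})_*\mu=\mu_i$ for all $i$; it has full support. The (full) groupoid C*-algebra $C^*(X_\infty\times X_\infty)$ of the pair groupoid of $X_\infty$ with the Haar system $\{\mu\times\delta_x\}_{x\in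 X_\infty}$, that is, the enveloping C*-algebra of $C(X_\infty\times X_\infty)$ with product $(\phi_1*\phi_2)(x_1,x_2)=\int\phi_1(y,x_2)\phi_2(x_1,y)\,d\mu(y)$ and involution $\phi^*(x_1,x_2)=\overline{\phi(x_2,x_1)}$, is isomorphic to $A_\infty$, which in turn is isomorphic to $B_0(L^2(X_\infty,\mu))$: $$C^*(X_\infty\times X_\infty)\;\cong\;A_\infty\;\cong\;B_0(L^2(X_\infty,\mu)).$$ The isomorphisms $\Phi\colon C^*(X_\infty\times X_\infty)\to A_\infty$ and $\Psi\colon A_\infty\to B_0(L^2(X_\infty,\mu))$ can be chosen such that $\Psi\circ\Phi$ maps $h\in C(X_\infty\times X_\infty)$ to the integral operator $(T_h\psi)(x)=\int h(y,x)\psi(y)\,d\mu(y)$, and $\Psi$ maps the image in $A_\infty$ of $b\in B_0(L^2(X_i,\mu_i))$ to $u_{i,\infty}\,b\,u_{i,\infty}^*$, where $u_{i,\infty}\psi=\psi\circ R_{i,\infty}$. -/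

import Mathlib

open CategoryTheory MeasureTheory TopologicalSpace
open scoped ENNReal

universe u v w

noncomputable section

/-! ### Oriented graphs and their refinements -/

/-- A finite oriented graph with at most one edge between any two vertices, without loops, and
connected as an unoriented graph. -/
structure LatticeGraph : Type (u + 1) where
  V : Type u
  E : Type u
  [finite_V : Finite V]
  [finite_E : Finite E]
  src : E → V
  tgt : E → V
  edge_unique : ∀ e e' : E,
    (src e = src e' ∧ tgt e = tgt e') ∨ (src e = tgt e' ∧ tgt e = src e') → e = e'
  src_ne_tgt : ∀ e : E, src e ≠ tgt e
  [nonempty_V : Nonempty V]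
  connected : ∀ x y : V, Relation.EqvGen (fun x y => ∃ e : E, src e = x ∧ tgt e = y) x y

namespace LatticeGraph

attribute [instance] finite_V finite_E nonempty_V

instance (Λ : LatticeGraph.{u}) : Quiver.{u} Λ.V where
  Hom x y := {e : Λ.E // Λ.src e = x ∧ Λ.tgt e = y}

/-- An edge, as an arrow of the underlying quiver. -/
def arrow (Λ : LatticeGraph.{u}) (e : Λ.E) : Λ.src e ⟶ Λ.tgt e := ⟨e, rfl, rfl⟩

/-- The edge `d` is one of the edges of the path `p`. -/
def Occurs {Λ : LatticeGraph.{u}} (d : Λ.E) {x : Λ.V} : ∀ {y : Λ.V}, Quiver.Path x y → Prop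
  | _, .nil => False
  | _, .cons p e => Occurs d p ∨ e.1 = d

/-- The path category generated by a graph. -/
abbrev PathCat (Λ : LatticeGraph.{u}) : Type u := Paths Λ.V

/-- The map on vertices underlying a functor between path categories. -/
def mapVertex {Λ Λ' : LatticeGraph.{u}} (F : Λ.PathCat ⥤ Λ'.PathCat) (x : Λ.V) : Λ'.V :=
  F.obj x

/-- A functor between path categories, applied to a path. -/
def mapPath {Λ Λ' : LatticeGraph.{u}} (F : Λ.PathCat ⥤ Λ'.PathCat) {x y : Λ.V}
    (p : Quiver.Path x y) : Quiver.Path (mapVertex F x) (mapVertex F y) :=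
  F.map (X := x) (Y := y) p

/-- The image of an edge under a functor between path categories, as a path. -/
def edgeImage {Λ Λ' : LatticeGraph.{u}} (F : Λ.PathCat ⥤ Λ'.PathCat) (e : Λ.E) :
    Quiver.Path (mapVertex F (Λ.src e)) (mapVertex F (Λ.tgt e)) :=
  mapPath F (Λ.arrow e).toPath

/-- The conditions on a functor between path categories that make it a refinement. -/
structure IsRefinement {Λ Λ' : LatticeGraph.{u}} (F : Λ.PathCat ⥤ Λ'.PathCat) : Prop where
  obj_injective : Function.Injective (mapVertex F)
  nontrivial : ∀ e : Λ.E, (edgeImage F e).length ≠ 0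
  disjoint : ∀ e e' : Λ.E, e ≠ e' → ∀ d : Λ'.E, ¬ (Occurs d (edgeImage F e) ∧ Occurs d (edgeImage F e'))

theorem occurs_comp {Λ : LatticeGraph.{u}} (d : Λ.E) {x y z : Λ.V} (p : Quiver.Path x y)
    (q : Quiver.Path y z) : Occurs d (p.comp q) ↔ Occurs d p ∨ Occurs d q := by
  induction q with
  | nil => simp [Occurs]
  | cons q e ih => simp [Occurs, ih, or_assoc]

theorem mapPath_nil {Λ Λ' : LatticeGraph.{u}} (F : Λ.PathCat ⥤ Λ'.PathCat) (x : Λ.V) :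
    mapPath F (Quiver.Path.nil : Quiver.Path x x) = Quiver.Path.nil :=
  F.map_id _

theorem mapPath_comp {Λ Λ' : LatticeGraph.{u}} (F : Λ.PathCat ⥤ Λ'.PathCat) {x y z : Λ.V}
    (p : Quiver.Path x y) (q : Quiver.Path y z) :
    mapPath F (p.comp q) = (mapPath F p).comp (mapPath F q) :=
  F.map_comp (X := x) (Y := y) (Z := z) p q

theorem mapPath_cons {Λ Λ' : LatticeGraph.{u}} (F : Λ.PathCat ⥤ Λ'.PathCat) {x y z : Λ.V}
    (p : Quiver.Path x y) (e : y ⟶ z) :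
    mapPath F (p.cons e) = (mapPath F p).comp (mapPath F e.toPath) :=
  mapPath_comp F p e.toPath

theorem occurs_mapPath {Λ Λ' : LatticeGraph.{u}} (F : Λ.PathCat ⥤ Λ'.PathCat) {x y : Λ.V}
    (p : Quiver.Path x y) (d : Λ'.E) :
    Occurs d (mapPath F p) ↔ ∃ e, Occurs e p ∧ Occurs d (edgeImage F e) := by
  induction p with
  | nil => simp [mapPath_nil, Occurs]
  | @cons y z p e ih =>
    rw [mapPath_cons, occurs_comp, ih]
    obtain ⟨e, rfl, rfl⟩ := e
    constructor
    · rintro (⟨e', h, h'⟩ | h)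
      · exact ⟨e', Or.inl h, h'⟩
      · exact ⟨e, Or.inr rfl, h⟩
    · rintro ⟨e', h | rfl, h'⟩
      · exact Or.inl ⟨e', h, h'⟩
      · exact Or.inr h'

theorem length_mapPath {Λ Λ' : LatticeGraph.{u}} {F : Λ.PathCat ⥤ Λ'.PathCat}
    (hF : IsRefinement F) {x y : Λ.V} (p : Quiver.Path x y) (hp : p.length ≠ 0) :
    (mapPath F p).length ≠ 0 := by
  cases p with
  | nil => simp at hp
  | cons p e =>
    rw [mapPath_cons, Quiver.Path.length_comp]
    obtain ⟨e, rfl, rfl⟩ := e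
    have := hF.nontrivial e
    change (mapPath F _).length ≠ 0 at this
    intro h
    exact this (Nat.eq_zero_of_add_eq_zero_left h)

theorem IsRefinement.id (Λ : LatticeGraph.{u}) : IsRefinement (𝟭 Λ.PathCat) where
  obj_injective := fun _ _ h => h
  nontrivial e := by
    change ((Λ.arrow e).toPath).length ≠ 0
    simp
  disjoint e e' h d := by
    change ¬ (Occurs d (Λ.arrow e).toPath ∧ Occurs d (Λ.arrow e').toPath)
    rintro ⟨h1 | h1, h2 | h2⟩
    · exact h1
    · exact h1
    · exact h2
    · exact h (h1.trans h2.symm)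

theorem IsRefinement.comp {Λ Λ' Λ'' : LatticeGraph.{u}} {F : Λ.PathCat ⥤ Λ'.PathCat}
    {F' : Λ'.PathCat ⥤ Λ''.PathCat} (hF : IsRefinement F) (hF' : IsRefinement F') :
    IsRefinement (F ⋙ F') where
  obj_injective := hF'.obj_injective.comp hF.obj_injective
  nontrivial e := length_mapPath hF' (edgeImage F e) (hF.nontrivial e)
  disjoint e e' h d := by
    change ¬ (Occurs d (mapPath F' (edgeImage F e)) ∧ Occurs d (mapPath F' (edgeImage F e')))
    rw [occurs_mapPath, occurs_mapPath]
    rintro ⟨⟨f, hf, hd⟩, ⟨f', hf', hd'⟩⟩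
    by_cases hff : f = f'
    · subst hff
      exact hF.disjoint e e' h f ⟨hf, hf'⟩
    · exact hF'.disjoint f f' hff d ⟨hd, hd'⟩

/-- The category of graphs and refinements. -/
instance : Category.{u} LatticeGraph.{u} where
  Hom Λ Λ' := {F : Λ.PathCat ⥤ Λ'.PathCat // IsRefinement F}
  id Λ := ⟨𝟭 _, IsRefinement.id Λ⟩
  comp F F' := ⟨F.1 ⋙ F'.1, F.2.comp F'.2⟩

/-! ### Configuration spaces and the gauge action -/

variable (G : Type v)

/-- The configuration space `G ^ E` of a graph. -/
def Config (Λ : LatticeGraph.{u}) : Type (max u v) := Λ.E → G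

/-- The gauge group `G ^ V` of a graph. -/
abbrev Gauge (Λ : LatticeGraph.{u}) : Type (max u v) := Λ.V → G

variable {G} (Λ : LatticeGraph.{u})

instance [TopologicalSpace G] : TopologicalSpace (Config G Λ) :=
  inferInstanceAs (TopologicalSpace (Λ.E → G))

instance [TopologicalSpace G] [CompactSpace G] : CompactSpace (Config G Λ) :=
  inferInstanceAs (CompactSpace (Λ.E → G))

instance [TopologicalSpace G] [T2Space G] : T2Space (Config G Λ) :=
  inferInstanceAs (T2Space (Λ.E → G))

instance [TopologicalSpace G] : MeasurableSpace (Config G Λ) := borel _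

instance [TopologicalSpace G] : BorelSpace (Config G Λ) := ⟨rfl⟩

variable [Group G]

instance : Group (Config G Λ) := inferInstanceAs (Group (Λ.E → G))

instance [TopologicalSpace G] [IsTopologicalGroup G] : IsTopologicalGroup (Config G Λ) :=
  inferInstanceAs (IsTopologicalGroup (Λ.E → G))

/-- The gauge group acts by `(g • a) e = g (src e) * a e * (g (tgt e))⁻¹`. -/
instance : MulAction (Gauge G Λ) (Config G Λ) where
  smul g a := fun e => g (Λ.src e) * a e * (g (Λ.tgt e))⁻¹
  one_smul a := by
    funext e
    change (1 : G) * a e * (1 : G)⁻¹ = a e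
    simp
  mul_smul g h a := by
    funext e
    change (g (Λ.src e) * h (Λ.src e)) * a e * (g (Λ.tgt e) * h (Λ.tgt e))⁻¹ =
      g (Λ.src e) * (h (Λ.src e) * a e * (h (Λ.tgt e))⁻¹) * (g (Λ.tgt e))⁻¹
    simp [mul_assoc]

theorem gauge_smul_apply (g : Gauge G Λ) (a : Config G Λ) (e : Λ.E) :
    (g • a) e = g (Λ.src e) * a e * (g (Λ.tgt e))⁻¹ := rfl

variable {Λ}

/-- The product `a e₁ * ⋯ * a eₙ` along the path `(e₁, …, eₙ)`. -/
def holonomy (a : Config G Λ) {x : Λ.V} : ∀ {y : Λ.V}, Quiver.Path x y → G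
  | _, .nil => 1
  | _, .cons p e => holonomy a p * a e.1

theorem holonomy_comp (a : Config G Λ) {x y z : Λ.V} (p : Quiver.Path x y)
    (q : Quiver.Path y z) : holonomy a (p.comp q) = holonomy a p * holonomy a q := by
  induction q with
  | nil => simp [holonomy]
  | cons q e ih => simp [holonomy, ih, mul_assoc]

theorem holonomy_toPath (a : Config G Λ) (e : Λ.E) : holonomy a (Λ.arrow e).toPath = a e := by
  change 1 * a e = a e
  simp

/-- A transformation of configurations that multiplies each edge of a path by vertex factors
changes the holonomy of the path by the factors of its end points. -/
theorem holonomy_transform (a b : Config G Λ) (c : Λ.V → G) {x y : Λ.V} (p : Quiver.Path x y)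
    (h : ∀ d, Occurs d p → b d = c (Λ.src d) * a d * (c (Λ.tgt d))⁻¹) :
    holonomy b p = c x * holonomy a p * (c y)⁻¹ := by
  induction p with
  | nil => simp [holonomy]
  | cons p e ih =>
    obtain ⟨e, rfl, rfl⟩ := e
    have h1 := ih fun d hd => h d (Or.inl hd)
    have h2 := h e (Or.inr rfl)
    change holonomy b p * b e = c x * (holonomy a p * a e) * (c (Λ.tgt e))⁻¹
    rw [h1, h2]
    group

theorem continuous_holonomy [TopologicalSpace G] [IsTopologicalGroup G] {x y : Λ.V}
    (p : Quiver.Path x y) : Continuous fun a : Config G Λ => holonomy a p := by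
  induction p with
  | nil => exact continuous_const
  | cons p e ih => exact ih.mul (continuous_apply (A := fun _ : Λ.E => G) e.1)

variable {Λ' Λ'' : LatticeGraph.{u}}

/-- The map between configuration spaces induced by a refinement. -/
def restrict (F : Λ ⟶ Λ') (a : Config G Λ') : Config G Λ :=
  fun e => holonomy a (edgeImage F.1 e)

theorem continuous_restrict [TopologicalSpace G] [IsTopologicalGroup G] (F : Λ ⟶ Λ') :
    Continuous (restrict F : Config G Λ' → Config G Λ) :=
  continuous_pi fun e => continuous_holonomy (edgeImage F.1 e)

theorem holonomy_restrict (F : Λ ⟶ Λ') (a : Config G Λ') {x y : Λ.V} (p : Quiver.Path x y) :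
    holonomy (restrict F a) p = holonomy a (mapPath F.1 p) := by
  induction p with
  | nil => rw [mapPath_nil]; rfl
  | cons p e ih =>
    obtain ⟨e, rfl, rfl⟩ := e
    rw [mapPath_cons, holonomy_comp, ← ih]
    rfl

theorem restrict_id (a : Config G Λ) : restrict (𝟙 Λ) a = a := by
  funext e
  exact holonomy_toPath a e

theorem restrict_comp (F : Λ ⟶ Λ') (F' : Λ' ⟶ Λ'') (a : Config G Λ'') :
    restrict (F ≫ F') a = restrict F (restrict F' a) := by
  funext e
  exact (holonomy_restrict F' a (edgeImage F.1 e)).symm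

theorem restrict_smul (F : Λ ⟶ Λ') (g : Gauge G Λ') (a : Config G Λ') :
    restrict F (g • a) = (fun x => g (mapVertex F.1 x) : Gauge G Λ) • restrict F a := by
  funext e
  exact holonomy_transform a (g • a) g (edgeImage F.1 e) fun d _ => gauge_smul_apply Λ' g a d

/-! ### Haar measures -/

section Haar

variable [TopologicalSpace G] [IsTopologicalGroup G] [CompactSpace G]

variable (G Λ) in
/-- The normalized Haar measure of the compact group `G ^ E`. -/
def haar : Measure (Config G Λ) := Measure.haarMeasure ⊤

instance : (haar G Λ).IsHaarMeasure := by unfold haar; infer_instance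

instance : IsProbabilityMeasure (haar G Λ) :=
  ⟨by
    have := Measure.haarMeasure_self (K₀ := (⊤ : PositiveCompacts (Config G Λ)))
    simpa [haar] using this⟩

theorem eq_haar (m : Measure (Config G Λ)) [IsProbabilityMeasure m] [m.IsMulLeftInvariant] :
    m = haar G Λ := by
  have h := Measure.isMulInvariant_eq_smul_of_compactSpace m (haar G Λ)
  have h1 : m Set.univ = (Measure.haarScalarFactor m (haar G Λ) • haar G Λ) Set.univ := by
    rw [← h]
  simp only [measure_univ, Measure.smul_apply, ENNReal.smul_def, smul_eq_mul, mul_one] at h1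
  rw [h]
  ext s _
  simp [ENNReal.smul_def, ← h1]

theorem map_mul_right_haar (r : Config G Λ) : (haar G Λ).map (fun a => a * r) = haar G Λ := by
  have hr : Measurable fun a : Config G Λ => a * r := (continuous_mul_const r).measurable
  have : IsProbabilityMeasure ((haar G Λ).map fun a => a * r) :=
    Measure.isProbabilityMeasure_map hr.aemeasurable
  have : ((haar G Λ).map fun a => a * r).IsMulLeftInvariant := ⟨fun l => by
    have hl : Measurable fun a : Config G Λ => l * a := (continuous_const_mul l).measurable
    rw [Measure.map_map hl hr]
    have : (fun a => l * a) ∘ (fun a : Config G Λ => a * r) =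
        (fun a => a * r) ∘ (fun a => l * a) := by
      funext a
      simp [mul_assoc]
    rw [this, ← Measure.map_map hr hl, map_mul_left_eq_self]⟩
  exact eq_haar _

/-- Refinements transport Haar measure to Haar measure. -/
theorem measurePreserving_restrict (F : Λ ⟶ Λ') :
    MeasurePreserving (restrict F) (haar G Λ') (haar G Λ) := by
  classical
  have hm : Measurable (restrict F : Config G Λ' → Config G Λ) :=
    (continuous_restrict F).measurable
  refine ⟨hm, ?_⟩
  have : IsProbabilityMeasure ((haar G Λ').map (restrict F)) :=
    Measure.isProbabilityMeasure_map hm.aemeasurable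
  have : ((haar G Λ').map (restrict F)).IsMulLeftInvariant := ⟨fun h => by
    have hh : Measurable fun a : Config G Λ => h * a := (continuous_const_mul h).measurable
    let c : Λ'.E → Λ'.V → G := fun d v =>
      if H : ∃ e, Occurs d (edgeImage F.1 e) then
        if v = mapVertex F.1 (Λ.src H.choose) then h H.choose else 1 else 1
    have hc : ∀ d e, Occurs d (edgeImage F.1 e) →
        c d = fun v => if v = mapVertex F.1 (Λ.src e) then h e else 1 := by
      intro d e hd
      have H : ∃ e, Occurs d (edgeImage F.1 e) := ⟨e, hd⟩
      have he : H.choose = e := by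
        by_contra hne
        exact F.2.disjoint _ _ hne d ⟨H.choose_spec, hd⟩
      funext v
      simp only [c, dif_pos H]
      rw [he]
    let l : Config G Λ' := fun d => c d (Λ'.src d)
    let r : Config G Λ' := fun d => (c d (Λ'.tgt d))⁻¹
    have key : (fun a : Config G Λ => h * a) ∘ restrict F =
        restrict F ∘ (fun a => a * r) ∘ (fun a => l * a) := by
      funext a e
      have ht := holonomy_transform a (l * a * r)
        (fun v => if v = mapVertex F.1 (Λ.src e) then h e else 1) (edgeImage F.1 e) (fun d hd => by
          change c d (Λ'.src d) * a d * (c d (Λ'.tgt d))⁻¹ = _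
          rw [hc d e hd])
      have hne : mapVertex F.1 (Λ.tgt e) ≠ mapVertex F.1 (Λ.src e) :=
        fun h => Λ.src_ne_tgt e (F.2.obj_injective h).symm
      change h e * holonomy a (edgeImage F.1 e) = holonomy (l * a * r) (edgeImage F.1 e)
      rw [ht, if_neg hne, if_pos rfl]
      simp
    have hl : Measurable fun a : Config G Λ' => l * a := (continuous_const_mul l).measurable
    have hr : Measurable fun a : Config G Λ' => a * r := (continuous_mul_const r).measurable
    rw [Measure.map_map hh hm, key, ← Measure.map_map hm (hr.comp hl), ← Measure.map_map hr hl,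
      map_mul_left_eq_self, map_mul_right_haar]⟩
  exact eq_haar _

end Haar

/-! ### Reduced configuration spaces -/

variable (G Λ) in
/-- The space of gauge orbits of configurations. -/
def RedConfig : Type (max u v) := Quotient (MulAction.orbitRel (Gauge G Λ) (Config G Λ))

/-- The quotient map onto the space of gauge orbits. -/
def toRed (a : Config G Λ) : RedConfig G Λ :=
  Quotient.mk (MulAction.orbitRel (Gauge G Λ) (Config G Λ)) a

/-- The map between spaces of gauge orbits induced by a refinement. -/
def redRestrict (F : Λ ⟶ Λ') : RedConfig G Λ' → RedConfig G Λ :=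
  Quotient.lift (fun a => toRed (restrict F a)) (by
    rintro a b ⟨g, rfl⟩
    refine Quotient.sound ⟨fun x => g (mapVertex F.1 x), ?_⟩
    exact (restrict_smul F g b).symm)

theorem redRestrict_toRed (F : Λ ⟶ Λ') (a : Config G Λ') :
    redRestrict F (toRed a) = toRed (restrict F a) := rfl

theorem redRestrict_id (a : RedConfig G Λ) : redRestrict (𝟙 Λ) a = a := by
  induction a using Quotient.inductionOn with
  | h a => exact congrArg toRed (restrict_id a)

theorem redRestrict_comp (F : Λ ⟶ Λ') (F' : Λ' ⟶ Λ'') (a : RedConfig G Λ'') :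
    redRestrict (F ≫ F') a = redRestrict F (redRestrict F' a) := by
  induction a using Quotient.inductionOn with
  | h a => exact congrArg toRed (restrict_comp F F' a)

section Topology

variable [TopologicalSpace G]

instance : TopologicalSpace (RedConfig G Λ) :=
  inferInstanceAs (TopologicalSpace (Quotient (MulAction.orbitRel (Gauge G Λ) (Config G Λ))))

instance : MeasurableSpace (RedConfig G Λ) := borel _

instance : BorelSpace (RedConfig G Λ) := ⟨rfl⟩

theorem continuous_toRed : Continuous (toRed : Config G Λ → RedConfig G Λ) :=
  continuous_quotient_mk'

instance [CompactSpace G] : CompactSpace (RedConfig G Λ) :=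
  inferInstanceAs (CompactSpace (Quotient (MulAction.orbitRel (Gauge G Λ) (Config G Λ))))

variable [IsTopologicalGroup G]

instance : ContinuousSMul (Gauge G Λ) (Config G Λ) where
  continuous_smul := continuous_pi fun e =>
    (((continuous_apply (Λ.src e)).comp continuous_fst).mul
      ((continuous_apply (A := fun _ : Λ.E => G) e).comp continuous_snd)).mul
      ((continuous_apply (Λ.tgt e)).comp continuous_fst).inv

instance [CompactSpace G] [T2Space G] : T2Space (RedConfig G Λ) := by
  have : ProperSMul (Gauge G Λ) (Config G Λ) :=
    ⟨(continuous_smul.prodMk continuous_snd).isProperMap⟩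
  exact inferInstanceAs (T2Space (Quotient (MulAction.orbitRel (Gauge G Λ) (Config G Λ))))

theorem continuous_redRestrict (F : Λ ⟶ Λ') :
    Continuous (redRestrict F : RedConfig G Λ' → RedConfig G Λ) :=
  Continuous.quotient_lift (continuous_toRed.comp (continuous_restrict F)) _

variable [CompactSpace G]

variable (G Λ) in
/-- The image of Haar measure on the space of gauge orbits. -/
def redHaar : Measure (RedConfig G Λ) := (haar G Λ).map toRed

theorem measurePreserving_redRestrict (F : Λ ⟶ Λ') :
    MeasurePreserving (redRestrict F) (redHaar G Λ') (redHaar G Λ) := by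
  refine ⟨(continuous_redRestrict F).measurable, ?_⟩
  unfold redHaar
  rw [Measure.map_map (continuous_redRestrict F).measurable continuous_toRed.measurable]
  have : redRestrict F ∘ toRed = toRed ∘ (restrict F : Config G Λ' → Config G Λ) := rfl
  rw [this, ← Measure.map_map continuous_toRed.measurable (continuous_restrict F).measurable,
    (measurePreserving_restrict F).map_eq]

end Topology

end LatticeGraph


/-! ### Compact operators -/

section Compact

variable {H : Type u} [NormedAddCommGroup H] [InnerProductSpace ℂ H] [CompleteSpace H]
variable {K : Type v} [NormedAddCommGroup K] [InnerProductSpace ℂ K] [CompleteSpace K]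

theorem IsCompactOperator.star_clm {T : H →L[ℂ] H} (hT : IsCompactOperator T) :
    IsCompactOperator (star T : H →L[ℂ] H) := by
  have hS : IsCompactOperator (T * star T : H →L[ℂ] H) := hT.comp_clm (star T)
  have hest : ∀ z : H, ‖(star T) z‖ ^ 2 ≤ ‖(T * star T) z‖ * ‖z‖ := by
    intro z
    have h1 : inner ℂ ((T * star T) z) z = inner ℂ ((star T) z) ((star T) z) := by
      rw [ContinuousLinearMap.star_eq_adjoint, ContinuousLinearMap.adjoint_inner_right]
      rfl
    have h2 : ‖inner ℂ ((star T) z) ((star T) z)‖ = ‖(star T) z‖ ^ 2 := by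
      rw [inner_self_eq_norm_sq_to_K]
      simp
    rw [← h2, ← h1]
    exact norm_inner_le_norm _ _
  refine (isCompactOperator_iff_isCompact_closure_image_closedBall
    (star T : H →L[ℂ] H).toLinearMap one_pos).2 ?_
  have hSc := (isCompactOperator_iff_isCompact_closure_image_closedBall
    (T * star T : H →L[ℂ] H).toLinearMap one_pos).1 hS
  refine (TotallyBounded.closure ?_).isCompact_of_isClosed isClosed_closure
  rw [Metric.totallyBounded_iff]
  intro ε hε
  have hSt := (hSc.totallyBounded).subset subset_closure
  obtain ⟨t, hts, htf, ht⟩ := Metric.finite_approx_of_totallyBounded hSt (ε ^ 2 / 2)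
    (by positivity)
  choose g hg using fun z : t => hts z.2
  have : Finite t := htf
  refine ⟨Set.range fun z => (star T : H →L[ℂ] H) (g z), Set.finite_range _, ?_⟩
  rintro _ ⟨x, hx, rfl⟩
  have hx' := ht ⟨x, hx, rfl⟩
  simp only [Set.mem_iUnion] at hx' ⊢
  obtain ⟨z, hz, hxy⟩ := hx'
  refine ⟨(star T : H →L[ℂ] H) (g ⟨z, hz⟩), ⟨⟨z, hz⟩, rfl⟩, ?_⟩
  obtain ⟨hy, hyz⟩ := hg ⟨z, hz⟩
  generalize g ⟨z, hz⟩ = y at hy hyz ⊢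
  change (T * star T : H →L[ℂ] H) y = z at hyz
  subst hyz
  rw [Metric.mem_ball, dist_eq_norm] at hxy ⊢
  have hb : ‖x - y‖ ≤ 2 := by
    have h1 : ‖x‖ ≤ 1 := by simpa using hx
    have h2 : ‖y‖ ≤ 1 := by simpa using hy
    linarith [norm_sub_le x y]
  have h3 := hest (x - y)
  rw [map_sub, map_sub] at h3
  have h4 : ‖(star T : H →L[ℂ] H) x - (star T : H →L[ℂ] H) y‖ ^ 2 < ε ^ 2 := by
    have h5 : ‖(T * star T) x - (T * star T) y‖ < ε ^ 2 / 2 := hxy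
    nlinarith [norm_nonneg ((T * star T) x - (T * star T) y), norm_nonneg (x - y)]
  exact lt_of_pow_lt_pow_left₀ 2 hε.le h4

variable (H) in
/-- The C⋆-algebra of compact operators on a Hilbert space. -/
def CompactOps : NonUnitalStarSubalgebra ℂ (H →L[ℂ] H) where
  carrier := {T | IsCompactOperator T}
  add_mem' hS hT := hS.add hT
  zero_mem' := isCompactOperator_zero
  mul_mem' {_ T} hS _ := hS.comp_clm T
  smul_mem' c _ hT := hT.smul c
  star_mem' hT := hT.star_clm

instance : IsClosed (CompactOps H : Set (H →L[ℂ] H)) :=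
  isClosed_setOfPred_isCompactOperator

/-- Conjugation `T ↦ u T u⋆` of bounded operators by an isometry. -/
def conjOp (u : H →ₗᵢ[ℂ] K) (T : H →L[ℂ] H) : K →L[ℂ] K :=
  u.toContinuousLinearMap ∘L T ∘L u.toContinuousLinearMap.adjoint

theorem conjOp_apply (u : H →ₗᵢ[ℂ] K) (T : H →L[ℂ] H) (x : K) :
    conjOp u T x = u (T (u.toContinuousLinearMap.adjoint x)) := rfl

theorem conjOp_mul (u : H →ₗᵢ[ℂ] K) (S T : H →L[ℂ] H) :
    conjOp u (S * T) = conjOp u S * conjOp u T := by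
  ext x
  have h : ∀ z, u.toContinuousLinearMap.adjoint (u z) = z :=
    fun z => DFunLike.congr_fun u.adjoint_comp_self z
  change _ = conjOp u S (conjOp u T x)
  rw [conjOp_apply, conjOp_apply, conjOp_apply, h]
  rfl

theorem conjOp_star (u : H →ₗᵢ[ℂ] K) (T : H →L[ℂ] H) :
    conjOp u (star T) = star (conjOp u T) := by
  unfold conjOp
  rw [ContinuousLinearMap.star_eq_adjoint, ContinuousLinearMap.star_eq_adjoint,
    ContinuousLinearMap.adjoint_comp, ContinuousLinearMap.adjoint_comp,
    ContinuousLinearMap.adjoint_adjoint, ContinuousLinearMap.comp_assoc]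

theorem conjOp_add (u : H →ₗᵢ[ℂ] K) (S T : H →L[ℂ] H) :
    conjOp u (S + T) = conjOp u S + conjOp u T := by
  ext x
  exact map_add u _ _

theorem conjOp_zero (u : H →ₗᵢ[ℂ] K) : conjOp u (0 : H →L[ℂ] H) = 0 := by
  ext x
  exact map_zero u

theorem conjOp_smul (u : H →ₗᵢ[ℂ] K) (c : ℂ) (T : H →L[ℂ] H) :
    conjOp u (c • T) = c • conjOp u T := by
  ext x
  exact map_smul u c _

/-- Conjugation `b ↦ u b u⋆` of compact operators by an isometry, a ⋆-homomorphism. -/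
def CompactOps.conj (u : H →ₗᵢ[ℂ] K) : CompactOps H →⋆ₙₐ[ℂ] CompactOps K where
  toFun b := ⟨conjOp u b.1,
    (b.2.comp_clm u.toContinuousLinearMap.adjoint).clm_comp u.toContinuousLinearMap⟩
  map_smul' c b := Subtype.ext (conjOp_smul u c b.1)
  map_zero' := Subtype.ext (conjOp_zero u)
  map_add' b c := Subtype.ext (conjOp_add u b.1 c.1)
  map_mul' b c := Subtype.ext (conjOp_mul u b.1 c.1)
  map_star' b := Subtype.ext (conjOp_star u b.1)

end Compact

/-! ### Bounded families of operators -/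

/-- The C⋆-algebra of bounded families of bounded operators on a family of Hilbert spaces (that is,
of block diagonal operators on their direct sum). -/
def BlockOps {ι : Type u} (H : ι → Type v) [∀ i, NormedAddCommGroup (H i)]
    [∀ i, InnerProductSpace ℂ (H i)] [∀ i, CompleteSpace (H i)] : Type (max u v) :=
  lp (fun i => H i →L[ℂ] H i) ∞

instance {ι : Type u} (H : ι → Type v) [∀ i, NormedAddCommGroup (H i)]
    [∀ i, InnerProductSpace ℂ (H i)] [∀ i, CompleteSpace (H i)] :
    NonUnitalCStarAlgebra (BlockOps H) :=
  inferInstanceAs (NonUnitalCStarAlgebra (lp (fun i => H i →L[ℂ] H i) ∞))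

/-- The C⋆-subalgebra generated by a set. -/
def generatedCStar {A : Type u} [NonUnitalCStarAlgebra A] (s : Set A) :
    NonUnitalStarSubalgebra ℂ A :=
  (NonUnitalStarAlgebra.adjoin ℂ s).topologicalClosure

instance {A : Type u} [NonUnitalCStarAlgebra A] (s : Set A) :
    IsClosed (generatedCStar s : Set A) :=
  NonUnitalStarSubalgebra.isClosed_topologicalClosure _

theorem mem_generatedCStar {A : Type u} [NonUnitalCStarAlgebra A] {s : Set A} {x : A}
    (hx : x ∈ s) : x ∈ generatedCStar s :=
  NonUnitalStarSubalgebra.le_topologicalClosure _ (NonUnitalStarAlgebra.subset_adjoin ℂ s hx)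

/-! ### Direct limits of C⋆-algebras -/

section DirectLimit

variable {I : Type u} [Preorder I] {A : I → Type v} [∀ i, NonUnitalCStarAlgebra (A i)]

/-- A representation on a Hilbert space of a direct system of C⋆-algebras: a compatible family of
representations of its members. -/
structure SystemRep (φ : ∀ ⦃i j : I⦄, i ≤ j → A i →⋆ₙₐ[ℂ] A j) : Type (max u v + 1) where
  H : Type (max u v)
  [normed : NormedAddCommGroup H]
  [inner : InnerProductSpace ℂ H]
  [complete : CompleteSpace H]
  rep : ∀ i, A i →⋆ₙₐ[ℂ] (H →L[ℂ] H)
  compatible : ∀ ⦃i j : I⦄ (h : i ≤ j) (a : A i), rep j (φ h a) = rep i a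

attribute [instance] SystemRep.normed SystemRep.inner SystemRep.complete

variable (φ : ∀ ⦃i j : I⦄, i ≤ j → A i →⋆ₙₐ[ℂ] A j)

/-- The family of the images of `a` under all representations of the system; it is bounded by
`‖a‖`. -/
def universalImage (i : I) (a : A i) : BlockOps fun ρ : SystemRep φ => ρ.H :=
  ⟨fun ρ => ρ.rep i a, memℓp_infty ⟨‖a‖, by
    rintro _ ⟨ρ, rfl⟩
    exact NonUnitalStarAlgHom.norm_apply_le (ρ.rep i) a⟩⟩

/-- The direct limit, in the category of C⋆-algebras, of a direct system: the C⋆-algebra generated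
by the members of the system in the universal (direct sum of all) representation of the system.
Its norm is the supremum over all representations, so that every compatible family of
⋆-homomorphisms factors uniquely through it. -/
def CStarDirectLimit : Type (max u v + 1) :=
  generatedCStar {x | ∃ (i : I) (a : A i), universalImage φ i a = x}

instance : NonUnitalCStarAlgebra (CStarDirectLimit φ) :=
  inferInstanceAs (NonUnitalCStarAlgebra
    (generatedCStar {x | ∃ (i : I) (a : A i), universalImage φ i a = x}))

/-- The canonical map of a member of a direct system to the direct limit. -/
def CStarDirectLimit.of (i : I) (a : A i) : CStarDirectLimit φ :=
  ⟨universalImage φ i a, mem_generatedCStar ⟨i, a, rfl⟩⟩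

end DirectLimit

/-! ### The C⋆-algebra of a pair groupoid -/

section PairGroupoid

variable {X : Type u} [TopologicalSpace X] [CompactSpace X] [MeasurableSpace X] [BorelSpace X]
variable (μ : Measure X)

/-- The convolution product of the pair groupoid `X × X`. -/
def pairConv [IsFiniteMeasureOnCompacts μ] (f g : C(X × X, ℂ)) : C(X × X, ℂ) where
  toFun p := ∫ y, f (y, p.2) * g (p.1, y) ∂μ
  continuous_toFun := by
    rw [← continuousOn_univ]
    exact continuousOn_integral_of_compact_support (k := Set.univ)
      (f := fun (p : X × X) y => f (y, p.2) * g (p.1, y)) isCompact_univ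
      (Continuous.continuousOn (by unfold Function.uncurry; fun_prop)) (fun _ _ _ h => (h (Set.mem_univ _)).elim)

/-- The involution of the pair groupoid `X × X`. -/
def pairStar (f : C(X × X, ℂ)) : C(X × X, ℂ) where
  toFun p := star (f (p.2, p.1))

/-- The `I`-norm on the convolution algebra of the pair groupoid `X × X`: the larger one of the
suprema over `x` of the integrals of `|f|` over the source fibre and over the target fibre of
`x`. -/
def pairINorm (f : C(X × X, ℂ)) : ℝ :=
  max (⨆ x, ∫ y, ‖f (x, y)‖ ∂μ) (⨆ x, ∫ y, ‖f (y, x)‖ ∂μ)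

variable [IsFiniteMeasureOnCompacts μ]

/-- A bounded ⋆-representation of the convolution algebra of the pair groupoid `X × X`. -/
structure PairRep : Type (u + 1) where
  H : Type u
  [normed : NormedAddCommGroup H]
  [inner : InnerProductSpace ℂ H]
  [complete : CompleteSpace H]
  rep : C(X × X, ℂ) →ₗ[ℂ] (H →L[ℂ] H)
  map_conv : ∀ f g, rep (pairConv μ f g) = rep f * rep g
  map_star : ∀ f, rep (pairStar f) = star (rep f)
  norm_le : ∀ f, ‖rep f‖ ≤ pairINorm μ f

attribute [instance] PairRep.normed PairRep.inner PairRep.complete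

/-- The family of the images of `f` under all bounded ⋆-representations. -/
def pairUniversalImage (f : C(X × X, ℂ)) : BlockOps fun ρ : PairRep μ => ρ.H :=
  ⟨fun ρ => ρ.rep f, memℓp_infty ⟨pairINorm μ f, by
    rintro _ ⟨ρ, rfl⟩
    exact ρ.norm_le f⟩⟩

/-- The (full) groupoid C⋆-algebra of the pair groupoid `X × X` of a compact space `X`, for the
Haar system given by `μ`: the completion of the convolution algebra in the norm
`f ↦ sup ‖π f‖`, the supremum over all bounded ⋆-representations `π`, realized as the closure of
the convolution algebra in its universal representation. -/
def PairGroupoidCStar : Type (u + 1) := generatedCStar (Set.range (pairUniversalImage μ))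

instance : NonUnitalCStarAlgebra (PairGroupoidCStar μ) :=
  inferInstanceAs (NonUnitalCStarAlgebra (generatedCStar (Set.range (pairUniversalImage μ))))

/-- The canonical map of the convolution algebra to the groupoid C⋆-algebra. -/
def PairGroupoidCStar.of (f : C(X × X, ℂ)) : PairGroupoidCStar μ :=
  ⟨pairUniversalImage μ f, mem_generatedCStar ⟨f, rfl⟩⟩

end PairGroupoid

/-! ### Inverse systems of compact measure spaces -/

/-- An inverse system of compact Hausdorff spaces with an exact inverse system of Borel
measures. -/
structure MeasInvSystem (I : Type u) [Preorder I] : Type (max u (v + 1)) where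
  X : I → Type v
  [top : ∀ i, TopologicalSpace (X i)]
  [compact : ∀ i, CompactSpace (X i)]
  [t2 : ∀ i, T2Space (X i)]
  [meas : ∀ i, MeasurableSpace (X i)]
  [borel : ∀ i, BorelSpace (X i)]
  R : ∀ ⦃i j : I⦄, i ≤ j → X j → X i
  continuous_R : ∀ ⦃i j : I⦄ (h : i ≤ j), Continuous (R h)
  R_id : ∀ (i : I) (x : X i), R (le_refl i) x = x
  R_comp : ∀ ⦃i j k : I⦄ (hij : i ≤ j) (hjk : j ≤ k) (x : X k),
    R (hij.trans hjk) x = R hij (R hjk x)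
  μ : ∀ i, Measure (X i)
  measurePreserving_R : ∀ ⦃i j : I⦄ (h : i ≤ j), MeasurePreserving (R h) (μ j) (μ i)

namespace MeasInvSystem

attribute [instance] top compact t2 meas borel

variable {I : Type u} [Preorder I] (S : MeasInvSystem.{u, v} I)

/-- The inverse limit space, as a subspace of the product. -/
def Limit : Type (max u v) := {a : ∀ i, S.X i // ∀ ⦃i j : I⦄ (h : i ≤ j), a i = S.R h (a j)}

instance : TopologicalSpace S.Limit := instTopologicalSpaceSubtype

instance : MeasurableSpace S.Limit := _root_.borel _

instance : BorelSpace S.Limit := ⟨rfl⟩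

instance : CompactSpace S.Limit := by
  have h : IsClosed {a : ∀ i, S.X i | ∀ ⦃i j : I⦄ (h : i ≤ j), a i = S.R h (a j)} := by
    simp only [Set.ofPred_forall]
    exact isClosed_iInter fun i => isClosed_iInter fun j => isClosed_iInter fun h =>
      isClosed_eq (continuous_apply i) ((S.continuous_R h).comp (continuous_apply j))
  exact isCompact_iff_compactSpace.1 h.isCompact

instance : T2Space S.Limit := inferInstanceAs (T2Space (Subtype _))

/-- The canonical projections of the inverse limit. -/
def proj (i : I) (a : S.Limit) : S.X i := a.1 i

/-- The isometry `ψ ↦ ψ ∘ R` between the `L²` spaces. -/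
def isometry ⦃i j : I⦄ (h : i ≤ j) : Lp ℂ 2 (S.μ i) →ₗᵢ[ℂ] Lp ℂ 2 (S.μ j) :=
  Lp.compMeasurePreservingₗᵢ ℂ (S.R h) (S.measurePreserving_R h)

/-- The observable algebra, the compact operators on `L²`, of a member of the system. -/
abbrev Obs (i : I) : Type v := CompactOps (Lp ℂ 2 (S.μ i))

/-- The connecting map `b ↦ u b u⋆` between the observable algebras. -/
def connect ⦃i j : I⦄ (h : i ≤ j) : S.Obs i →⋆ₙₐ[ℂ] S.Obs j := CompactOps.conj (S.isometry h)

/-- The limit observable algebra. -/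
abbrev LimitObs := CStarDirectLimit S.connect

end MeasInvSystem

namespace LatticeGraph

variable {I : Type u} [Preorder I] (G : Type v) [Group G] [TopologicalSpace G]
  [IsTopologicalGroup G] [CompactSpace G] [T2Space G] (Λ : I ⥤ LatticeGraph.{w})

/-- The inverse system of the configuration spaces of a direct system of graphs, with the
normalized Haar measures. -/
def configSystem : MeasInvSystem.{u, max v w} I where
  X i := Config G (Λ.obj i)
  R _ _ h := restrict (Λ.map (homOfLE h))
  continuous_R _ _ h := continuous_restrict _
  R_id i x := by
    have : homOfLE (le_refl i) = 𝟙 i := rfl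
    rw [this, Λ.map_id, restrict_id]
  R_comp i j k hij hjk x := by
    rw [← restrict_comp, ← Λ.map_comp, homOfLE_comp]
  μ i := haar G (Λ.obj i)
  measurePreserving_R _ _ h := measurePreserving_restrict _

/-- The inverse system of the spaces of gauge orbits of a direct system of graphs, with the
images of the normalized Haar measures. -/
def reducedSystem : MeasInvSystem.{u, max v w} I where
  X i := RedConfig G (Λ.obj i)
  R _ _ h := redRestrict (Λ.map (homOfLE h))
  continuous_R _ _ h := continuous_redRestrict _
  R_id i x := by
    have : homOfLE (le_refl i) = 𝟙 i := rfl
    rw [this, Λ.map_id, redRestrict_id]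
  R_comp i j k hij hjk x := by
    rw [← redRestrict_comp, ← Λ.map_comp, homOfLE_comp]
  μ i := redHaar G (Λ.obj i)
  measurePreserving_R _ _ h := measurePreserving_redRestrict _

end LatticeGraph

end

/-! Both C⋆-algebras act faithfully on `L²` of the inverse limit, and in each case the image is the
algebra of all compact operators; `Φ` is obtained by comparing the two actions. Graphs enter only
through the fact that the `μ i` are regular probability measures of full support.

Measure: full support makes the connecting maps surjective, and compactness then makes the
projections surjective. So a function pulled back from some `X i` has an integral independent of
`i`. This positive functional extends to all continuous functions (`riesz_extension`), and the Riesz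
representation theorem gives `μ`. Uniqueness and full support follow from Stone–Weierstrass:
pullbacks are uniformly dense (`dense_cylinder`).

Direct limit: the isometries `u i` into `L²(μ)` have increasing ranges with dense union, so the
range projections `P i` converge strongly to the identity. For compact `T` this gives `P i * T * P i
→ T` in norm (`exists_norm_sub_conj_lt`). Conjugation by an isometry preserves norms, so the limit
algebra is the closure of the images.

Groupoid algebra: operators with continuous kernels are compact and dense in the compact operators.
It remains to see that the integral operator `T_g` already has the universal norm. The sup norm of
the `m`-th convolution power of `g` is at most `‖g‖ ^ 2 * ‖T_g‖ ^ (m - 2)`. Taking `m`-th roots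
bounds the norm of a self-adjoint image of `g` under any bounded representation by `‖T_g‖`, and the
C⋆-identity removes self-adjointness (`PairRep.norm_rep_le`). The Schur test (`norm_integralOp_le`)
shows that the integral operators are themselves among the representations. -/

namespace MeasInvSystem

/-! ### Projections and cylinder functions of an inverse limit -/

variable {I : Type u} [Preorder I] (S : MeasInvSystem.{u, v} I)

theorem continuous_proj (i : I) : Continuous (S.proj i) :=
  (continuous_apply i).comp continuous_subtype_val

theorem R_proj {i j : I} (h : i ≤ j) (a : S.Limit) : S.R h (S.proj j a) = S.proj i a :=
  (a.2 h).symm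

/-- The complement of the compact range is open with empty preimage, hence a null set; full support
makes it empty. -/
theorem surjective_R [∀ i, (S.μ i).IsOpenPosMeasure] {i j : I} (h : i ≤ j) :
    Function.Surjective (S.R h) := by
  have hc : IsClosed (Set.range (S.R h)) := (isCompact_range (S.continuous_R h)).isClosed
  have h0 : S.μ i (Set.range (S.R h))ᶜ = 0 := by
    rw [← (S.measurePreserving_R h).measure_preimage hc.isOpen_compl.measurableSet.nullMeasurableSet]
    simp
  rw [← Set.range_eq_univ, ← Set.compl_empty_iff]
  exact hc.isOpen_compl.measure_eq_zero_iff _ |>.1 h0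

/-- A compactness argument: the points of the product that lie over `x` and are compatible below one
index `m` form closed non-empty sets, which decrease as `m` grows. A common point is compatible
everywhere. -/
theorem surjective_proj [IsDirectedOrder I] [∀ i, (S.μ i).IsOpenPosMeasure]
    [∀ i, Nonempty (S.X i)] (k : I) : Function.Surjective (S.proj k) := by
  classical
  intro x
  let T : Set.Ici k → Set (∀ i, S.X i) := fun m =>
    {a | a k = x} ∩ ⋂ (i : I) (h : i ≤ m), {a | a i = S.R h (a m)}
  have hcl : ∀ m, IsClosed (T m) := fun m =>
    (isClosed_eq (continuous_apply k) continuous_const).inter <|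
      isClosed_iInter fun i => isClosed_iInter fun h =>
        isClosed_eq (continuous_apply i) ((S.continuous_R h).comp (continuous_apply m.1))
  have hne : ∀ m, (T m).Nonempty := by
    rintro ⟨m, hm⟩
    obtain ⟨y, hy⟩ := S.surjective_R hm x
    -- Coordinates not below `m` are unconstrained and take arbitrary values.
    refine ⟨fun i => if h : i ≤ m then S.R h y else Classical.arbitrary _, ?_⟩
    refine ⟨?_, Set.mem_iInter₂.2 fun i h => ?_⟩
    · simp [Set.mem_Ici.1 hm, hy]
    · simp [h, S.R_id]
  have hdir : Directed (· ⊇ ·) T := by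
    intro m n
    obtain ⟨l, hml, hnl⟩ := exists_ge_ge m.1 n.1
    have key : ∀ m' : Set.Ici k, (h : m'.1 ≤ l) → T ⟨l, m'.2.trans h⟩ ⊆ T m' := by
      rintro ⟨m', hm'⟩ h a ⟨ha, hb⟩
      refine ⟨ha, Set.mem_iInter₂.2 fun i hi => ?_⟩
      rw [Set.mem_iInter₂] at hb
      have h1 : a i = S.R (hi.trans h) (a l) := hb i (hi.trans h)
      have h2 : a m' = S.R h (a l) := hb m' h
      change a i = S.R hi (a m')
      rw [h1, h2, S.R_comp]
    exact ⟨⟨l, m.2.trans hml⟩, key m hml, key n hnl⟩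
  have : Nonempty (Set.Ici k) := ⟨⟨k, le_rfl⟩⟩
  obtain ⟨a, ha⟩ := IsCompact.nonempty_iInter_of_directed_nonempty_isCompact_isClosed T hdir hne
    (fun m => (hcl m).isCompact) hcl
  rw [Set.mem_iInter] at ha
  refine ⟨⟨a, fun i j h => ?_⟩, (ha ⟨k, le_rfl⟩).1⟩
  obtain ⟨l, hkl, hjl⟩ := exists_ge_ge k j
  have hl := Set.mem_iInter₂.1 (ha ⟨l, hkl⟩).2
  have h1 : a i = S.R (h.trans hjl) (a l) := hl i (h.trans hjl)
  have h2 : a j = S.R hjl (a l) := hl j hjl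
  rw [h1, h2, S.R_comp]

variable (𝕜 : Type w) [RCLike 𝕜]

/-- The pullback of continuous functions along a projection of the inverse limit. -/
def pullback (i : I) (f : C(S.X i, 𝕜)) : C(S.Limit, 𝕜) := f.comp ⟨S.proj i, S.continuous_proj i⟩

theorem pullback_eq_of_le {i j : I} (h : i ≤ j) (f : C(S.X i, 𝕜)) :
    S.pullback 𝕜 i f = S.pullback 𝕜 j (f.comp ⟨S.R h, S.continuous_R h⟩) := by
  ext a
  exact congrArg f (S.R_proj h a).symm

theorem exists_common_pullback [IsDirectedOrder I] {i j : I} (f : C(S.X i, 𝕜)) (g : C(S.X j, 𝕜)) :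
    ∃ (k : I) (f' g' : C(S.X k, 𝕜)),
      S.pullback 𝕜 k f' = S.pullback 𝕜 i f ∧ S.pullback 𝕜 k g' = S.pullback 𝕜 j g := by
  obtain ⟨k, hik, hjk⟩ := exists_ge_ge i j
  exact ⟨k, _, _, (S.pullback_eq_of_le 𝕜 hik f).symm, (S.pullback_eq_of_le 𝕜 hjk g).symm⟩

/-- The algebra of continuous functions on the inverse limit that factor through a projection. -/
def cylinder [IsDirectedOrder I] [Nonempty I] : StarSubalgebra 𝕜 C(S.Limit, 𝕜) where
  carrier := {F | ∃ i f, S.pullback 𝕜 i f = F}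
  mul_mem' := by
    rintro _ _ ⟨i, f, rfl⟩ ⟨j, g, rfl⟩
    obtain ⟨k, f', g', hf, hg⟩ := S.exists_common_pullback 𝕜 f g
    exact ⟨k, f' * g', by rw [← hf, ← hg]; rfl⟩
  add_mem' := by
    rintro _ _ ⟨i, f, rfl⟩ ⟨j, g, rfl⟩
    obtain ⟨k, f', g', hf, hg⟩ := S.exists_common_pullback 𝕜 f g
    exact ⟨k, f' + g', by rw [← hf, ← hg]; rfl⟩
  algebraMap_mem' c := ⟨Classical.arbitrary I, algebraMap 𝕜 _ c, rfl⟩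
  star_mem' := by
    rintro _ ⟨i, f, rfl⟩
    exact ⟨i, star f, rfl⟩

/-- Stone–Weierstrass: distinct points differ in some coordinate, where a Urysohn function separates
them. -/
theorem dense_cylinder [IsDirectedOrder I] [Nonempty I] :
    Dense (S.cylinder 𝕜 : Set C(S.Limit, 𝕜)) := by
  have := ContinuousMap.starSubalgebra_topologicalClosure_eq_top_of_separatesPoints
    (S.cylinder 𝕜) (by
      intro a b hab
      obtain ⟨i, hi⟩ : ∃ i, S.proj i a ≠ S.proj i b := by
        by_contra! h
        exact hab (Subtype.ext (funext h))
      obtain ⟨f, hf0, hf1, -⟩ := exists_continuous_zero_one_of_isClosed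
        (isClosed_singleton (x := S.proj i a)) (isClosed_singleton (x := S.proj i b))
        (by simpa using hi)
      let f' : C(S.X i, 𝕜) := ⟨fun x => (f x : 𝕜), by fun_prop⟩
      refine ⟨_, ⟨S.pullback 𝕜 i f', ⟨i, f', rfl⟩, rfl⟩, ?_⟩
      change ((f (S.proj i a) : ℝ) : 𝕜) ≠ ((f (S.proj i b) : ℝ) : 𝕜)
      rw [hf0 rfl, hf1 rfl]
      simp)
  rw [dense_iff_closure_eq, ← StarSubalgebra.topologicalClosure_coe, this]
  rfl

theorem exists_pullback_near [IsDirectedOrder I] [Nonempty I] (F : C(S.Limit, 𝕜)) {ε : ℝ}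
    (hε : 0 < ε) : ∃ i f, ‖F - S.pullback 𝕜 i f‖ < ε := by
  obtain ⟨_, ⟨i, f, rfl⟩, h⟩ := (S.dense_cylinder 𝕜).exists_dist_lt F hε
  exact ⟨i, f, by rwa [← dist_eq_norm]⟩

end MeasInvSystem

/-! ### Regular measures on compact spaces -/

/-- For finite measures regularity amounts to inner regularity by compact sets, and continuous
images of compact sets are compact. -/
theorem MeasureTheory.Measure.Regular.map_of_continuous {X : Type u} {Y : Type v}
    [TopologicalSpace X] [MeasurableSpace X] [BorelSpace X]
    [TopologicalSpace Y] [T2Space Y] [MeasurableSpace Y] [BorelSpace Y]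
    (μ : Measure X) [IsFiniteMeasure μ] [μ.Regular] {f : X → Y} (hf : Continuous f) :
    (μ.map f).Regular := by
  have : (μ.map f).InnerRegular := Measure.InnerRegular.map_of_continuous hf
  infer_instance

theorem MeasureTheory.Measure.ext_of_integral_continuousMap_eq {X : Type u} [TopologicalSpace X]
    [CompactSpace X] [T2Space X] [MeasurableSpace X] [BorelSpace X] {μ ν : Measure X}
    [μ.Regular] [ν.Regular] (h : ∀ f : C(X, ℝ), ∫ x, f x ∂μ = ∫ x, f x ∂ν) : μ = ν :=
  Measure.ext_of_integral_eq_on_compactlySupported fun f => h f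

/-- A positive linear functional on the continuous functions of a compact Hausdorff space is the
integral for a regular measure. -/
theorem exists_regular_measure_of_nonneg {X : Type u} [TopologicalSpace X]
    [CompactSpace X] [T2Space X] [MeasurableSpace X] [BorelSpace X] (L : C(X, ℝ) →ₗ[ℝ] ℝ)
    (hL : ∀ f, 0 ≤ f → 0 ≤ L f) :
    ∃ μ : Measure X, μ.Regular ∧ IsFiniteMeasure μ ∧ ∀ f : C(X, ℝ), ∫ x, f x ∂μ = L f := by
  let Λ : CompactlySupportedContinuousMap X ℝ →ₚ[ℝ] ℝ := PositiveLinearMap.mk₀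
    { toFun := fun g => L g.toContinuousMap
      map_add' := fun f g => L.map_add f.toContinuousMap g.toContinuousMap
      map_smul' := fun c f => L.map_smul c f.toContinuousMap } (fun f hf => hL _ fun x => hf x)
  refine ⟨RealRMK.rieszMeasure Λ, inferInstance, inferInstance, fun f => ?_⟩
  exact RealRMK.integral_rieszMeasure Λ (CompactlySupportedContinuousMap.continuousMapEquiv f)

theorem ContinuousMap.integrable {X : Type u} [TopologicalSpace X] [CompactSpace X]
    [MeasurableSpace X] [BorelSpace X] {E : Type v} [NormedAddCommGroup E]
    [SecondCountableTopologyEither X E]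
    (μ : Measure X) [IsFiniteMeasureOnCompacts μ] (f : C(X, E)) : Integrable f μ :=
  f.continuous.integrable_of_hasCompactSupport (HasCompactSupport.of_compactSpace f)

/-! ### The measure on the inverse limit -/

namespace MeasInvSystem

variable {I : Type u} [Preorder I] (S : MeasInvSystem.{u, v} I)

theorem integral_R {i j : I} (h : i ≤ j) (f : C(S.X i, ℝ)) :
    ∫ x, f (S.R h x) ∂S.μ j = ∫ x, f x ∂S.μ i := by
  rw [← (S.measurePreserving_R h).map_eq, integral_map (S.measurePreserving_R h).aemeasurable]
  exact f.continuous.aestronglyMeasurable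

theorem integral_pullback {ν : Measure S.Limit} {i : I}
    (hν : MeasurePreserving (S.proj i) ν (S.μ i)) (f : C(S.X i, ℝ)) :
    ∫ a, S.pullback ℝ i f a ∂ν = ∫ x, f x ∂S.μ i := by
  rw [← hν.map_eq, integral_map hν.aemeasurable f.continuous.aestronglyMeasurable]
  rfl

theorem isProbabilityMeasure_limit [Nonempty I] [∀ i, IsProbabilityMeasure (S.μ i)] {ν : Measure S.Limit}
    (hν : ∀ i, MeasurePreserving (S.proj i) ν (S.μ i)) : IsProbabilityMeasure ν := by
  have i := Classical.arbitrary I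
  constructor
  rw [← measure_univ (μ := S.μ i), ← (hν i).measure_preimage nullMeasurableSet_univ,
    Set.preimage_univ]

theorem exists_pullback [IsDirectedOrder I] [Nonempty I] {F : C(S.Limit, ℝ)}
    (hF : F ∈ Subalgebra.toSubmodule (S.cylinder ℝ).toSubalgebra) :
    ∃ i f, S.pullback ℝ i f = F := hF

section Integral

variable [IsDirectedOrder I]

variable [∀ i, (S.μ i).IsOpenPosMeasure] [∀ i, Nonempty (S.X i)]

/-- At a common later stage `k` the two functions agree pointwise, because `S.proj k` is surjective.
-/
theorem integral_eq_of_pullback_eq {i j : I} {f : C(S.X i, ℝ)} {g : C(S.X j, ℝ)}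
    (h : S.pullback ℝ i f = S.pullback ℝ j g) : ∫ x, f x ∂S.μ i = ∫ x, g x ∂S.μ j := by
  obtain ⟨k, hik, hjk⟩ := exists_ge_ge i j
  rw [← S.integral_R hik, ← S.integral_R hjk]
  congr 1
  funext x
  obtain ⟨a, rfl⟩ := S.surjective_proj k x
  rw [S.R_proj, S.R_proj]
  exact DFunLike.congr_fun h a

variable [Nonempty I]

/-- The integral of a function that factors through a projection of the inverse limit. -/
noncomputable def cylinderIntegral
    (F : Subalgebra.toSubmodule (S.cylinder ℝ).toSubalgebra) : ℝ :=
  ∫ x, (S.exists_pullback F.2).choose_spec.choose x ∂S.μ (S.exists_pullback F.2).choose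

theorem cylinderIntegral_eq {F : Subalgebra.toSubmodule (S.cylinder ℝ).toSubalgebra} {i : I}
    {f : C(S.X i, ℝ)} (h : S.pullback ℝ i f = F.1) :
    S.cylinderIntegral F = ∫ x, f x ∂S.μ i :=
  S.integral_eq_of_pullback_eq ((S.exists_pullback F.2).choose_spec.choose_spec.trans h.symm)

variable [∀ i, IsProbabilityMeasure (S.μ i)]

/-- The integral on the subspace of functions that factor through a projection, as a partially
defined linear functional. -/
noncomputable def cylinderFunctional : C(S.Limit, ℝ) →ₗ.[ℝ] ℝ where
  domain := Subalgebra.toSubmodule (S.cylinder ℝ).toSubalgebra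
  toFun :=
    { toFun := S.cylinderIntegral
      map_add' := by
        intro F F'
        obtain ⟨i, f, hf⟩ := S.exists_pullback F.2
        obtain ⟨j, g, hg⟩ := S.exists_pullback F'.2
        obtain ⟨k, f', g', hf', hg'⟩ := S.exists_common_pullback ℝ f g
        rw [hf] at hf'
        rw [hg] at hg'
        rw [S.cylinderIntegral_eq hf', S.cylinderIntegral_eq hg', S.cylinderIntegral_eq
          (f := f' + g') (by rw [Submodule.coe_add, ← hf', ← hg']; rfl)]
        exact integral_add (f'.integrable _) (g'.integrable _)
      map_smul' := by
        intro c F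
        obtain ⟨i, f, hf⟩ := S.exists_pullback F.2
        rw [S.cylinderIntegral_eq hf, S.cylinderIntegral_eq (f := c • f)
          (by rw [Submodule.coe_smul, ← hf]; rfl)]
        exact integral_smul c _ }

theorem exists_limit_measure [∀ i, (S.μ i).Regular] :
    ∃ μ : Measure S.Limit, μ.Regular ∧ IsFiniteMeasure μ ∧
      ∀ i, MeasurePreserving (S.proj i) μ (S.μ i) := by
  obtain ⟨L, hL, hpos⟩ := riesz_extension (PointedCone.positive ℝ C(S.Limit, ℝ))
    S.cylinderFunctional (by
      intro F h
      obtain ⟨i, f, hf⟩ := S.exists_pullback F.2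
      refine le_of_le_of_eq (integral_nonneg fun x => ?_) (S.cylinderIntegral_eq hf).symm
      -- Positivity descends from the limit to `X i` because every point of `X i` lifts.
      obtain ⟨a, rfl⟩ := S.surjective_proj i x
      rw [← hf] at h
      exact h a) (by
      intro F
      -- The extension theorem asks that every `F` become positive after adding an element of the
      -- domain; the constant `‖F‖` does it.
      refine ⟨⟨algebraMap ℝ _ ‖F‖, (S.cylinder ℝ).algebraMap_mem' _⟩, fun a => ?_⟩
      change 0 ≤ algebraMap ℝ C(S.Limit, ℝ) ‖F‖ a + F a
      have h1 := abs_le.1 (F.norm_coe_le_norm a)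
      have h2 : algebraMap ℝ C(S.Limit, ℝ) ‖F‖ a = ‖F‖ := rfl
      linarith [h1.1])
  obtain ⟨μ, hμ, hfin, hμL⟩ := exists_regular_measure_of_nonneg L hpos
  refine ⟨μ, hμ, hfin, fun i => ⟨(S.continuous_proj i).measurable, ?_⟩⟩
  have := Measure.Regular.map_of_continuous μ (S.continuous_proj i)
  refine Measure.ext_of_integral_continuousMap_eq fun f => ?_
  rw [integral_map (S.continuous_proj i).aemeasurable f.continuous.aestronglyMeasurable]
  refine (hμL (S.pullback ℝ i f)).trans ?_
  refine (hL ⟨S.pullback ℝ i f, ⟨i, f, rfl⟩⟩).trans ?_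
  exact S.cylinderIntegral_eq rfl

end Integral

variable [IsDirectedOrder I] [Nonempty I]

theorem limit_measure_unique [∀ i, IsProbabilityMeasure (S.μ i)] {μ ν : Measure S.Limit}
    [μ.Regular] [ν.Regular] (hμ : ∀ i, MeasurePreserving (S.proj i) μ (S.μ i))
    (hν : ∀ i, MeasurePreserving (S.proj i) ν (S.μ i)) : ν = μ := by
  have := S.isProbabilityMeasure_limit hμ
  have := S.isProbabilityMeasure_limit hν
  refine Measure.ext_of_integral_continuousMap_eq fun f => ?_
  have hc : ∀ m : Measure S.Limit, IsProbabilityMeasure m →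
      -- The integral is continuous in the sup norm, since it factors through `L¹`.
      Continuous fun f : C(S.Limit, ℝ) => ∫ a, f a ∂m := fun m _ =>
    (continuous_integral (μ := m)).comp (ContinuousMap.toLp (E := ℝ) 1 m ℝ).continuous |>.congr
      fun f => integral_congr_ae (ContinuousMap.coeFn_toLp m f)
  refine congrFun (Continuous.ext_on (S.dense_cylinder ℝ) (hc ν ‹_›) (hc μ ‹_›) ?_) f
  rintro _ ⟨i, f, rfl⟩
  exact (S.integral_pullback (hν i) f).trans (S.integral_pullback (hμ i) f).symm

/-- A Urysohn function that is `1` at `a` and `0` off `U` is approximated within `1 / 2` by a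
cylinder function `f`. Then `{1 / 2 < f}` is open and non-empty in some `X i`, and its preimage lies
in `U`. -/
theorem isOpenPosMeasure_limit [∀ i, (S.μ i).IsOpenPosMeasure] {μ : Measure S.Limit}
    (hμ : ∀ i, MeasurePreserving (S.proj i) μ (S.μ i)) : μ.IsOpenPosMeasure := by
  refine ⟨fun U hU ⟨a, ha⟩ h0 => ?_⟩
  obtain ⟨F, hF0, hF1, -⟩ := exists_continuous_zero_one_of_isClosed hU.isClosed_compl
    (isClosed_singleton (x := a)) (by simpa using ha)
  obtain ⟨i, f, hf⟩ := S.exists_pullback_near ℝ F (ε := 1 / 2) (by norm_num)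
  have hnear : ∀ b, |F b - f (S.proj i b)| < 1 / 2 := fun b =>
    ((F - S.pullback ℝ i f).norm_coe_le_norm b).trans_lt hf
  have hV : IsOpen {x | 1 / 2 < f x} := isOpen_lt continuous_const f.continuous
  refine hV.measure_ne_zero (S.μ i) ⟨S.proj i a, ?_⟩ ?_
  · have h1 := (abs_lt.1 (hnear a)).2
    rw [hF1 rfl] at h1
    change 1 / 2 < f (S.proj i a)
    norm_num at h1 ⊢
    linarith
  · rw [← (hμ i).measure_preimage hV.measurableSet.nullMeasurableSet]
    refine measure_mono_null (fun b hb => ?_) h0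
    by_contra hbU
    have h1 := (abs_lt.1 (hnear b)).1
    rw [hF0 hbU] at h1
    change 1 / 2 < f (S.proj i b) at hb
    norm_num at h1
    linarith

end MeasInvSystem

/-- A ⋆-homomorphism that is isometric on a ⋆-subalgebra induces an isomorphism of the generated
C⋆-algebra onto every closed ⋆-subalgebra in which the image is dense. -/
theorem exists_starAlgEquiv_generatedCStar {A : Type u} {C : Type v} [NonUnitalCStarAlgebra A]
    [NonUnitalCStarAlgebra C] (B : NonUnitalStarSubalgebra ℂ A) (π : A →⋆ₙₐ[ℂ] C)
    (K : NonUnitalStarSubalgebra ℂ C) (hK : IsClosed (K : Set C))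
    (hB : ∀ x ∈ B, ‖x‖ ≤ ‖π x‖) (hπ : ∀ x ∈ B, π x ∈ K)
    (hd : ∀ y ∈ K, ∀ ε > 0, ∃ x ∈ B, ‖y - π x‖ < ε) :
    ∃ e : generatedCStar (B : Set A) ≃⋆ₐ[ℂ] K, ∀ x, (e x : C) = π x := by
  have hπc : Continuous π := by
    have : LipschitzWith 1 π := LipschitzWith.of_dist_le_mul fun x y => by
      rw [dist_eq_norm, dist_eq_norm, ← map_sub]
      simpa using NonUnitalStarAlgHom.norm_apply_le π (x - y)
    exact this.continuous
  -- `B` is already a ⋆-subalgebra, so only the closure is left of the generation process.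
  have hgen : (generatedCStar (B : Set A) : Set A) = closure B := by
    unfold generatedCStar
    rw [NonUnitalStarAlgebra.adjoin_eq]
    rfl
  have hmemK : ∀ x : generatedCStar (B : Set A), π x ∈ K := by
    intro x
    have hx : (x : A) ∈ closure (B : Set A) := hgen ▸ x.2
    exact closure_minimal (t := π ⁻¹' K) (fun y hy => hπ y hy) (hK.preimage hπc) hx
  have hnorm : ∀ x : generatedCStar (B : Set A), ‖x‖ ≤ ‖π x‖ := by
    intro x
    have hx : (x : A) ∈ closure (B : Set A) := hgen ▸ x.2
    exact closure_minimal (t := {y | ‖y‖ ≤ ‖π y‖}) (fun y hy => hB y hy)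
      (isClosed_le continuous_norm hπc.norm) hx
  let f : generatedCStar (B : Set A) →⋆ₙₐ[ℂ] K :=
    NonUnitalStarAlgHom.codRestrict
      (π.comp (NonUnitalStarSubalgebraClass.subtype (generatedCStar (B : Set A)))) K hmemK
  have hf : ∀ x, (f x : C) = π x := fun x => rfl
  -- Contractivity of ⋆-homomorphisms is automatic; `hB`, extended to the closure, gives the other
  -- inequality. An isometric image of a complete space is closed, so density suffices for
  -- surjectivity.
  have hiso : Isometry f := AddMonoidHomClass.isometry_of_norm f fun x =>
    le_antisymm (NonUnitalStarAlgHom.norm_apply_le π x.1) (hnorm x)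
  have hcl : IsClosed (Set.range f) := hiso.isClosedEmbedding.isClosed_range
  have hsurj : Function.Surjective f := by
    intro y
    rw [← Set.mem_range, ← hcl.closure_eq, Metric.mem_closure_iff]
    intro ε hε
    obtain ⟨x, hx, h⟩ := hd y y.2 ε hε
    refine ⟨_, ⟨⟨x, mem_generatedCStar hx⟩, rfl⟩, ?_⟩
    rw [dist_eq_norm]
    exact h
  exact ⟨StarAlgEquiv.ofBijective f ⟨hiso.injective, hsurj⟩, hf⟩

/-- The evaluation of a bounded family of operators at an index. -/
def BlockOps.eval {ι : Type u} (H : ι → Type v) [∀ i, NormedAddCommGroup (H i)]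
    [∀ i, InnerProductSpace ℂ (H i)] [∀ i, CompleteSpace (H i)] (i : ι) :
    BlockOps H →⋆ₙₐ[ℂ] (H i →L[ℂ] H i) where
  toFun x := x.1 i
  map_smul' _ _ := rfl
  map_zero' := rfl
  map_add' _ _ := rfl
  map_mul' _ _ := rfl
  map_star' _ := rfl

theorem BlockOps.ext {ι : Type u} {H : ι → Type v} [∀ i, NormedAddCommGroup (H i)]
    [∀ i, InnerProductSpace ℂ (H i)] [∀ i, CompleteSpace (H i)] {x y : BlockOps H}
    (h : ∀ i, BlockOps.eval H i x = BlockOps.eval H i y) : x = y :=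
  Subtype.ext (funext h)

theorem BlockOps.norm_le {ι : Type u} {H : ι → Type v} [∀ i, NormedAddCommGroup (H i)]
    [∀ i, InnerProductSpace ℂ (H i)] [∀ i, CompleteSpace (H i)] {x : BlockOps H} {C : ℝ}
    (hC : 0 ≤ C) (h : ∀ i, ‖BlockOps.eval H i x‖ ≤ C) : ‖x‖ ≤ C :=
  lp.norm_le_of_forall_le hC h

/-! ### Direct limits of C⋆-algebras -/

section DirectLimit

variable {I : Type u} [Preorder I] {A : I → Type v}
  [∀ i, NonUnitalCStarAlgebra (A i)] (φ : ∀ ⦃i j : I⦄, i ≤ j → A i →⋆ₙₐ[ℂ] A j)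

theorem universalImage_connect {i j : I} (h : i ≤ j) (a : A i) :
    universalImage φ j (φ h a) = universalImage φ i a :=
  BlockOps.ext fun ρ => ρ.compatible h a

variable [IsDirectedOrder I]

theorem exists_common_universalImage {i j : I} (a : A i) (b : A j) : ∃ (k : I) (a' b' : A k),
    universalImage φ k a' = universalImage φ i a ∧ universalImage φ k b' = universalImage φ j b := by
  obtain ⟨k, hik, hjk⟩ := exists_ge_ge i j
  exact ⟨k, φ hik a, φ hjk b, universalImage_connect φ hik a, universalImage_connect φ hjk b⟩

variable [Nonempty I]

/-- The union of the images of the members of a direct system in its direct limit. -/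
def universalImages : NonUnitalStarSubalgebra ℂ (BlockOps fun ρ : SystemRep φ => ρ.H) where
  carrier := {x | ∃ (i : I) (a : A i), universalImage φ i a = x}
  add_mem' := by
    rintro _ _ ⟨i, a, rfl⟩ ⟨j, b, rfl⟩
    obtain ⟨k, a', b', ha, hb⟩ := exists_common_universalImage φ a b
    exact ⟨k, a' + b', by rw [← ha, ← hb]; exact BlockOps.ext fun ρ => map_add (ρ.rep k) a' b'⟩
  mul_mem' := by
    rintro _ _ ⟨i, a, rfl⟩ ⟨j, b, rfl⟩
    obtain ⟨k, a', b', ha, hb⟩ := exists_common_universalImage φ a b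
    exact ⟨k, a' * b', by rw [← ha, ← hb]; exact BlockOps.ext fun ρ => map_mul (ρ.rep k) a' b'⟩
  zero_mem' := ⟨Classical.arbitrary I, 0, BlockOps.ext fun ρ => map_zero (ρ.rep _)⟩
  smul_mem' := by
    rintro c _ ⟨i, a, rfl⟩
    exact ⟨i, c • a, BlockOps.ext fun ρ => map_smul (ρ.rep i) c a⟩
  star_mem' := by
    rintro _ ⟨i, a, rfl⟩
    exact ⟨i, star a, BlockOps.ext fun ρ => map_star (ρ.rep i) a⟩

/-- An isometric representation of a direct system identifies its direct limit with every closed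
⋆-algebra of operators in which the image of the system is dense. -/
theorem CStarDirectLimit.exists_starAlgEquiv (ρ : SystemRep φ)
    (K : NonUnitalStarSubalgebra ℂ (ρ.H →L[ℂ] ρ.H)) (hK : IsClosed (K : Set (ρ.H →L[ℂ] ρ.H)))
    (hρ : ∀ i a, ‖a‖ ≤ ‖ρ.rep i a‖) (hmem : ∀ i a, ρ.rep i a ∈ K)
    (hd : ∀ T ∈ K, ∀ ε > 0, ∃ i a, ‖T - ρ.rep i a‖ < ε) :
    ∃ Ψ : CStarDirectLimit φ ≃⋆ₐ[ℂ] K,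
      ∀ i a, (Ψ (CStarDirectLimit.of φ i a) : ρ.H →L[ℂ] ρ.H) = ρ.rep i a := by
  obtain ⟨e, he⟩ := exists_starAlgEquiv_generatedCStar (universalImages φ)
    (BlockOps.eval (fun ρ : SystemRep φ => ρ.H) ρ) K hK
    (by
      rintro _ ⟨i, a, rfl⟩
      -- Every representation is contractive and `ρ` is isometric on the members, so `ρ` attains the
      -- universal norm.
      exact BlockOps.norm_le (norm_nonneg _) fun σ =>
        (NonUnitalStarAlgHom.norm_apply_le (σ.rep i) a).trans (hρ i a))
    (by
      rintro _ ⟨i, a, rfl⟩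
      exact hmem i a)
    (by
      intro T hT ε hε
      obtain ⟨i, a, h⟩ := hd T hT ε hε
      exact ⟨_, ⟨i, a, rfl⟩, h⟩)
  exact ⟨e, fun i a => he _⟩

end DirectLimit

/-! ### Approximation of compact operators along increasing ranges -/

section Compact

variable {H : Type u} [NormedAddCommGroup H] [InnerProductSpace ℂ H] [CompleteSpace H]
variable {K : Type v} [NormedAddCommGroup K] [InnerProductSpace ℂ K] [CompleteSpace K]

theorem adjoint_isometry_apply (u : H →ₗᵢ[ℂ] K) (x : H) :
    u.toContinuousLinearMap.adjoint (u x) = x :=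
  DFunLike.congr_fun u.adjoint_comp_self x

theorem norm_adjoint_isometry_apply_le (u : H →ₗᵢ[ℂ] K) (y : K) :
    ‖u.toContinuousLinearMap.adjoint y‖ ≤ ‖y‖ := by
  have h : ‖u.toContinuousLinearMap.adjoint‖ ≤ 1 := by
    rw [LinearIsometryEquiv.norm_map]
    exact u.norm_toContinuousLinearMap_le
  simpa using (u.toContinuousLinearMap.adjoint).le_of_opNorm_le h y

/-- The orthogonal projection `u u⋆` onto the range of an isometry. -/
noncomputable def rangeProj (u : H →ₗᵢ[ℂ] K) : K →L[ℂ] K :=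
  u.toContinuousLinearMap ∘L u.toContinuousLinearMap.adjoint

theorem rangeProj_apply (u : H →ₗᵢ[ℂ] K) (y : K) :
    rangeProj u y = u (u.toContinuousLinearMap.adjoint y) := rfl

theorem star_rangeProj (u : H →ₗᵢ[ℂ] K) : star (rangeProj u) = rangeProj u := by
  rw [rangeProj, ContinuousLinearMap.star_eq_adjoint, ContinuousLinearMap.adjoint_comp,
    ContinuousLinearMap.adjoint_adjoint]

theorem norm_rangeProj_apply_le (u : H →ₗᵢ[ℂ] K) (y : K) : ‖rangeProj u y‖ ≤ ‖y‖ := by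
  rw [rangeProj_apply, u.norm_map]
  exact norm_adjoint_isometry_apply_le u y

theorem norm_rangeProj_le (u : H →ₗᵢ[ℂ] K) : ‖rangeProj u‖ ≤ 1 :=
  ContinuousLinearMap.opNorm_le_bound _ zero_le_one fun y => by
    simpa using norm_rangeProj_apply_le u y

/-- The projection fixes `u x`, so `y` may be replaced by `y - u x`; the constant is `1 + 1`, the
second summand bounding the projection. -/
theorem norm_sub_rangeProj_apply_le (u : H →ₗᵢ[ℂ] K) (y : K) (x : H) :
    ‖y - rangeProj u y‖ ≤ 2 * ‖y - u x‖ := by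
  have h : y - rangeProj u y = (y - u x) - rangeProj u (y - u x) := by
    rw [map_sub, rangeProj_apply u (u x), adjoint_isometry_apply]
    abel
  rw [h]
  linarith [norm_sub_le (y - u x) (rangeProj u (y - u x)), norm_rangeProj_apply_le u (y - u x)]

theorem norm_le_norm_conjOp (u : H →ₗᵢ[ℂ] K) (T : H →L[ℂ] H) : ‖T‖ ≤ ‖conjOp u T‖ := by
  refine ContinuousLinearMap.opNorm_le_bound _ (norm_nonneg _) fun x => ?_
  have h := (conjOp u T).le_opNorm (u x)
  rwa [conjOp_apply, adjoint_isometry_apply, u.norm_map, u.norm_map] at h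

variable {I : Type w} [Preorder I] {F : I → Type u}
  [∀ i, NormedAddCommGroup (F i)] [∀ i, InnerProductSpace ℂ (F i)] [∀ i, CompleteSpace (F i)]
  (U : ∀ i, F i →ₗᵢ[ℂ] K)

/-- Contractions converging strongly to the identity converge uniformly on totally bounded sets. The
hypothesis `hU` says that the ranges increase, without reference to connecting maps, so that finite
spans can be treated as well. -/
theorem eventually_forall_norm_sub_rangeProj_lt
    (hU : ∀ i j, i ≤ j → ∀ x, ∃ y, U j y = U i x)
    (hd : ∀ y, ∀ ε > 0, ∃ i x, ‖y - U i x‖ < ε) {s : Set K} (hs : TotallyBounded s)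
    {ε : ℝ} (hε : 0 < ε) :
    ∀ᶠ i in Filter.atTop, ∀ y ∈ s, ‖y - rangeProj (U i) y‖ < ε := by
  have hpt : ∀ y, ∀ᶠ i in Filter.atTop, ‖y - rangeProj (U i) y‖ < ε / 3 := by
    intro y
    -- Half of `ε / 3`, to absorb the factor `2` of `norm_sub_rangeProj_apply_le`.
    obtain ⟨i, x, h⟩ := hd y (ε / 6) (by positivity)
    filter_upwards [Filter.eventually_ge_atTop i] with j hj
    obtain ⟨x', hx'⟩ := hU i j hj x
    have := norm_sub_rangeProj_apply_le (U j) y x'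
    rw [hx'] at this
    linarith
  obtain ⟨t, -, htf, ht⟩ := Metric.finite_approx_of_totallyBounded hs (ε / 3) (by positivity)
  filter_upwards [(Filter.eventually_all_finite htf).2 fun y _ => hpt y] with i hi z hz
  have hz' := ht hz
  simp only [Set.mem_iUnion] at hz'
  obtain ⟨y, hy, hzy⟩ := hz'
  rw [Metric.mem_ball, dist_eq_norm] at hzy
  have h1 := hi y hy
  have h2 := norm_rangeProj_apply_le (U i) (z - y)
  have h3 : z - rangeProj (U i) z =
      (z - y) + (y - rangeProj (U i) y) - rangeProj (U i) (z - y) := by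
    rw [map_sub]
    abel
  rw [h3]
  linarith [norm_sub_le ((z - y) + (y - rangeProj (U i) y)) (rangeProj (U i) (z - y)),
    norm_add_le (z - y) (y - rangeProj (U i) y)]

/-- `T` maps the unit ball to a totally bounded set, on which the projections converge uniformly. -/
theorem eventually_norm_sub_rangeProj_mul_le
    (hU : ∀ i j, i ≤ j → ∀ x, ∃ y, U j y = U i x)
    (hd : ∀ y, ∀ ε > 0, ∃ i x, ‖y - U i x‖ < ε) {T : K →L[ℂ] K} (hT : IsCompactOperator T)
    {ε : ℝ} (hε : 0 < ε) :
    ∀ᶠ i in Filter.atTop, ‖T - rangeProj (U i) * T‖ ≤ ε := by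
  have hc := ((isCompactOperator_iff_isCompact_closure_image_closedBall
    T.toLinearMap one_pos).1 hT).totallyBounded.subset subset_closure
  filter_upwards [eventually_forall_norm_sub_rangeProj_lt U hU hd hc hε] with i hi
  exact ContinuousLinearMap.opNorm_le_of_unit_norm hε.le fun x hx =>
    (hi (T x) ⟨x, by simp [hx], rfl⟩).le

variable [IsDirectedOrder I] [Nonempty I]

/-- For an increasing family of isometries whose ranges have dense union, every compact operator is
approximated in norm by compact operators on the ranges. -/
theorem exists_norm_sub_conj_lt
    (hU : ∀ i j, i ≤ j → ∀ x, ∃ y, U j y = U i x)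
    (hd : ∀ y, ∀ ε > 0, ∃ i x, ‖y - U i x‖ < ε) {T : K →L[ℂ] K} (hT : IsCompactOperator T)
    {ε : ℝ} (hε : 0 < ε) :
    ∃ (i : I) (b : CompactOps (F i)), ‖T - CompactOps.conj (U i) b‖ < ε := by
  obtain ⟨i, h1, h2⟩ := ((eventually_norm_sub_rangeProj_mul_le U hU hd hT
    (ε := ε / 3) (by positivity)).and (eventually_norm_sub_rangeProj_mul_le U hU hd hT.star_clm
    (ε := ε / 3) (by positivity))).exists
  have hb : (U i).toContinuousLinearMap.adjoint ∘L T ∘L (U i).toContinuousLinearMap ∈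
      CompactOps (F i) :=
    (hT.comp_clm (U i).toContinuousLinearMap).clm_comp (U i).toContinuousLinearMap.adjoint
  refine ⟨i, ⟨_, hb⟩, ?_⟩
  -- Taking adjoints turns the estimate for `star T` into one for multiplication on the right.
  have h3 : ‖T - T * rangeProj (U i)‖ ≤ ε / 3 := by
    rw [← norm_star, star_sub, star_mul, star_rangeProj]
    exact h2
  have h4 : T - (CompactOps.conj (U i) ⟨_, hb⟩ : K →L[ℂ] K) =
      (T - rangeProj (U i) * T) + rangeProj (U i) * (T - T * rangeProj (U i)) := by
    rw [mul_sub, ← mul_assoc]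
    ext x
    change T x - rangeProj (U i) (T (rangeProj (U i) x)) = T x - rangeProj (U i) (T x) +
      (rangeProj (U i) (T x) - rangeProj (U i) (T (rangeProj (U i) x)))
    abel
  rw [h4]
  have h5 : ‖rangeProj (U i) * (T - T * rangeProj (U i))‖ ≤ ε / 3 := by
    refine (norm_mul_le _ _).trans ?_
    nlinarith [norm_rangeProj_le (U i), norm_nonneg (T - T * rangeProj (U i)),
      norm_nonneg (rangeProj (U i))]
  linarith [norm_add_le (T - rangeProj (U i) * T) (rangeProj (U i) * (T - T * rangeProj (U i)))]

end Compact

/-! ### Finite-rank approximation -/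

section FiniteRank

variable {H : Type u} [NormedAddCommGroup H] [InnerProductSpace ℂ H] [CompleteSpace H]

instance (t : Finset H) : CompleteSpace (Submodule.span ℂ (t : Set H)) :=
  FiniteDimensional.complete ℂ _

/-- The inclusion of the span of a finite set. -/
noncomputable def spanIsometry (t : Finset H) : Submodule.span ℂ (t : Set H) →ₗᵢ[ℂ] H :=
  (Submodule.span ℂ (t : Set H)).subtypeₗᵢ

/-- The spans of finite sets, directed by inclusion, are an increasing family of ranges whose union
is everything. -/
theorem exists_finset_forall_norm_sub_rangeProj_lt {s : Set H} (hs : TotallyBounded s)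
    {ε : ℝ} (hε : 0 < ε) : ∃ t : Finset H, ∀ y ∈ s, ‖y - rangeProj (spanIsometry t) y‖ < ε := by
  classical
  refine (eventually_forall_norm_sub_rangeProj_lt (fun t : Finset H => spanIsometry t) ?_ ?_
    hs hε).exists
  · exact fun t t' h x => ⟨⟨x, Submodule.span_mono (Finset.coe_subset.2 h) x.2⟩, rfl⟩
  · intro y ε hε
    refine ⟨{y}, ⟨y, Submodule.subset_span (by simp)⟩, ?_⟩
    simpa [spanIsometry] using hε

theorem isCompactOperator_rangeProj_spanIsometry (t : Finset H) :
    IsCompactOperator (rangeProj (spanIsometry t)) := by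
  have : ProperSpace (Submodule.span ℂ (t : Set H)) := FiniteDimensional.proper ℂ _
  have h : IsCompactOperator (spanIsometry t).toContinuousLinearMap :=
    isCompactOperator_of_locallyCompactSpace_rng (spanIsometry t).toContinuousLinearMap
  exact h.comp_clm (spanIsometry t).toContinuousLinearMap.adjoint

/-- With an orthonormal basis `b` of the span, the product is the sum over `k` of the rank-one
operators `x ↦ ⟪star T (b k), x⟫ • b k`. -/
theorem rangeProj_spanIsometry_mul_mem {R : Submodule ℂ (H →L[ℂ] H)}
    (hR : ∀ x y, InnerProductSpace.rankOne ℂ x y ∈ R) (t : Finset H) (T : H →L[ℂ] H) :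
    rangeProj (spanIsometry t) * T ∈ R := by
  let b := stdOrthonormalBasis ℂ (Submodule.span ℂ (t : Set H))
  have h : rangeProj (spanIsometry t) * T =
      ∑ k, InnerProductSpace.rankOne ℂ (spanIsometry t (b k)) (star T (spanIsometry t (b k))) := by
    ext x
    change rangeProj (spanIsometry t) (T x) = _
    rw [rangeProj_apply, ← b.sum_repr' ((spanIsometry t).toContinuousLinearMap.adjoint (T x)),
      map_sum, sum_apply]
    refine Finset.sum_congr rfl fun k _ => ?_
    rw [map_smul, InnerProductSpace.rankOne_apply, ContinuousLinearMap.adjoint_inner_right,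
      ContinuousLinearMap.star_eq_adjoint, ContinuousLinearMap.adjoint_inner_left]
    rfl
  rw [h]
  exact R.sum_mem fun k _ => hR _ _

/-- A closed space of operators that contains the operators of rank one contains all compact
operators. -/
theorem IsCompactOperator.mem_of_rankOne_mem {R : Submodule ℂ (H →L[ℂ] H)}
    (hcl : IsClosed (R : Set (H →L[ℂ] H))) (hR : ∀ x y, InnerProductSpace.rankOne ℂ x y ∈ R)
    {T : H →L[ℂ] H} (hT : IsCompactOperator T) : T ∈ R := by
  have hc := ((isCompactOperator_iff_isCompact_closure_image_closedBall
    T.toLinearMap one_pos).1 hT).totallyBounded.subset subset_closure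
  rw [← SetLike.mem_coe, ← hcl.closure_eq, Metric.mem_closure_iff]
  intro ε hε
  obtain ⟨t, ht⟩ := exists_finset_forall_norm_sub_rangeProj_lt hc (half_pos hε)
  refine ⟨_, rangeProj_spanIsometry_mul_mem hR t T, ?_⟩
  rw [dist_eq_norm]
  exact (ContinuousLinearMap.opNorm_le_of_unit_norm (half_pos hε).le fun x hx =>
    (ht (T x) ⟨x, by simp [hx], rfl⟩).le).trans_lt (half_lt_self hε)

end FiniteRank

/-! ### Integral operators with continuous kernels -/

section IntegralOperator

variable {X : Type u} [TopologicalSpace X]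

/-- The partial function `y ↦ h (y, x)`. -/
noncomputable def kernelRow (h : C(X × X, ℂ)) (x : X) : C(X, ℂ) := (h.comp ContinuousMap.prodSwap).curry x

theorem kernelRow_apply (h : C(X × X, ℂ)) (x y : X) : kernelRow h x y = h (y, x) := rfl

theorem continuous_kernelRow (h : C(X × X, ℂ)) : Continuous (kernelRow h) :=
  (h.comp ContinuousMap.prodSwap).curry.continuous

variable [CompactSpace X]

theorem norm_kernelRow_le (h : C(X × X, ℂ)) (x : X) : ‖kernelRow h x‖ ≤ ‖h‖ :=
  (ContinuousMap.norm_le _ (norm_nonneg _)).2 fun y => h.norm_coe_le_norm (y, x)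

theorem norm_curry_le (h : C(X × X, ℂ)) (x : X) : ‖h.curry x‖ ≤ ‖h‖ :=
  (ContinuousMap.norm_le _ (norm_nonneg _)).2 fun y => h.norm_coe_le_norm (x, y)

variable [MeasurableSpace X] [BorelSpace X] (μ : Measure X)

theorem ContinuousMap.continuous_integral_prod [IsFiniteMeasureOnCompacts μ] {E : Type v}
    [NormedAddCommGroup E] [NormedSpace ℝ E] (F : C(X × X, E)) :
    Continuous fun x => ∫ y, F (x, y) ∂μ := by
  rw [← continuousOn_univ]
  exact continuousOn_integral_of_compact_support (k := Set.univ) (f := fun x y => F (x, y))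
    isCompact_univ (Continuous.continuousOn F.continuous) fun _ _ _ h => (h (Set.mem_univ _)).elim

/-- `X` need not be second countable, so the Borel sets of `X × X` may exceed the product σ-algebra;
the form of Fubini's theorem for compactly supported continuous functions avoids this. -/
theorem ContinuousMap.integral_integral_swap [IsFiniteMeasureOnCompacts μ] {E : Type v}
    [NormedAddCommGroup E] [NormedSpace ℝ E] (F : C(X × X, E)) :
    ∫ x, ∫ y, F (x, y) ∂μ ∂μ = ∫ y, ∫ x, F (x, y) ∂μ ∂μ :=
  integral_integral_swap_of_hasCompactSupport (f := fun x y => F (x, y)) F.continuous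
    (HasCompactSupport.of_compactSpace _)

variable [IsProbabilityMeasure μ]

/-- The map of the continuous functions to `L²`. -/
noncomputable abbrev toL2 : C(X, ℂ) →L[ℂ] Lp ℂ 2 μ := ContinuousMap.toLp 2 μ ℂ

theorem norm_toL2_le (f : C(X, ℂ)) : ‖toL2 μ f‖ ≤ ‖f‖ := by
  have h : ‖toL2 μ‖ ≤ 1 := by
    refine (ContinuousMap.toLp_norm_le (p := 2) (E := ℂ) (𝕜 := ℂ) μ).trans (le_of_eq ?_)
    simp [measureUnivNNReal]
  simpa using (toL2 μ).le_of_opNorm_le h f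

/-- The function `x ↦ ∫ h (y, x) ψ y`, which is continuous for every `ψ` in `L²`. -/
noncomputable def kernelFun (h : C(X × X, ℂ)) : Lp ℂ 2 μ →L[ℂ] C(X, ℂ) :=
  LinearMap.mkContinuous
    -- The conjugate compensates the conjugate-linear first slot. Continuity in `x` comes from
    -- continuity of the rows in `L²`.
    { toFun := fun ψ => ⟨fun x => inner ℂ (toL2 μ (star (kernelRow h x))) ψ,
        ((toL2 μ).continuous.comp (continuous_kernelRow h).star).inner continuous_const⟩
      map_add' := fun ψ χ => by
        ext x
        exact inner_add_right (𝕜 := ℂ) (toL2 μ (star (kernelRow h x))) ψ χ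
      map_smul' := fun c ψ => by
        ext x
        exact inner_smul_right (𝕜 := ℂ) (toL2 μ (star (kernelRow h x))) ψ c }
    ‖h‖ fun ψ => (ContinuousMap.norm_le _ (by positivity)).2 fun x =>
      (norm_inner_le_norm _ _).trans (mul_le_mul_of_nonneg_right
        ((norm_toL2_le μ _).trans ((norm_star _).trans_le (norm_kernelRow_le h x)))
        (norm_nonneg _))

theorem kernelFun_apply (h : C(X × X, ℂ)) (ψ : Lp ℂ 2 μ) (x : X) :
    kernelFun μ h ψ x = inner ℂ (toL2 μ (star (kernelRow h x))) ψ := rfl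

theorem kernelFun_apply_eq_integral (h : C(X × X, ℂ)) (ψ : Lp ℂ 2 μ) (x : X) :
    kernelFun μ h ψ x = ∫ y, h (y, x) * ψ y ∂μ := by
  rw [kernelFun_apply, L2.inner_def]
  refine integral_congr_ae ?_
  filter_upwards [ContinuousMap.coeFn_toLp (p := 2) (𝕜 := ℂ) μ (star (kernelRow h x))] with y hy
  rw [hy]
  simp [kernelRow_apply, mul_comm]

theorem kernelFun_toL2_apply (h : C(X × X, ℂ)) (f : C(X, ℂ)) (x : X) :
    kernelFun μ h (toL2 μ f) x = ∫ y, h (y, x) * f y ∂μ := by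
  rw [kernelFun_apply_eq_integral]
  refine integral_congr_ae ?_
  filter_upwards [ContinuousMap.coeFn_toLp (p := 2) (𝕜 := ℂ) μ f] with y hy
  rw [hy]

theorem norm_kernelFun_apply_le (h : C(X × X, ℂ)) (ψ : Lp ℂ 2 μ) (x : X) :
    ‖kernelFun μ h ψ x‖ ≤ ‖h‖ * ‖ψ‖ :=
  (norm_inner_le_norm _ _).trans (mul_le_mul_of_nonneg_right
    ((norm_toL2_le μ _).trans ((norm_star _).trans_le (norm_kernelRow_le h x))) (norm_nonneg _))

/-- The integral operator with a continuous kernel. -/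
noncomputable def integralOp : C(X × X, ℂ) →ₗ[ℂ] (Lp ℂ 2 μ →L[ℂ] Lp ℂ 2 μ) where
  toFun h := toL2 μ ∘L kernelFun μ h
  map_add' f g := by
    ext1 ψ
    change toL2 μ _ = toL2 μ _ + toL2 μ _
    rw [← map_add]
    congr 1
    ext x
    change kernelFun μ (f + g) ψ x = kernelFun μ f ψ x + kernelFun μ g ψ x
    rw [kernelFun_apply, kernelFun_apply, kernelFun_apply, ← inner_add_left, ← map_add, ← star_add]
    rfl
  map_smul' c f := by
    ext1 ψ
    change toL2 μ _ = c • toL2 μ _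
    rw [← map_smul]
    congr 1
    ext x
    change kernelFun μ (c • f) ψ x = c * kernelFun μ f ψ x
    have h : star (kernelRow (c • f) x) = star c • star (kernelRow f x) := by
      rw [← star_smul]
      rfl
    rw [kernelFun_apply, kernelFun_apply, h, map_smul, inner_smul_left]
    simp

theorem integralOp_apply (h : C(X × X, ℂ)) (ψ : Lp ℂ 2 μ) :
    integralOp μ h ψ = toL2 μ (kernelFun μ h ψ) := rfl

theorem integralOp_apply_ae (h : C(X × X, ℂ)) (ψ : Lp ℂ 2 μ) :
    (integralOp μ h ψ : X → ℂ) =ᵐ[μ] fun x => ∫ y, h (y, x) * ψ y ∂μ := by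
  rw [integralOp_apply]
  filter_upwards [ContinuousMap.coeFn_toLp (p := 2) (𝕜 := ℂ) μ (kernelFun μ h ψ)] with x hx
  rw [hx, kernelFun_apply_eq_integral]

/-- The conjugated rows of the kernel form a compact set in `L²`, so one finite-rank projection `P`
moves all of them by less than `ε / 2`. As values of the image function are inner products with
these vectors, composing with `P` changes the operator by at most `ε / 2`. -/
theorem isCompactOperator_integralOp (h : C(X × X, ℂ)) : IsCompactOperator (integralOp μ h) := by
  have hs : TotallyBounded (Set.range fun x => toL2 μ (star (kernelRow h x))) :=
    (isCompact_range ((toL2 μ).continuous.comp (continuous_kernelRow h).star)).totallyBounded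
  change integralOp μ h ∈ {T : Lp ℂ 2 μ →L[ℂ] Lp ℂ 2 μ | IsCompactOperator T}
  rw [← isClosed_setOfPred_isCompactOperator.closure_eq, Metric.mem_closure_iff]
  intro ε hε
  obtain ⟨t, ht⟩ := exists_finset_forall_norm_sub_rangeProj_lt hs (half_pos hε)
  refine ⟨integralOp μ h ∘L rangeProj (spanIsometry t),
    (isCompactOperator_rangeProj_spanIsometry t).clm_comp (integralOp μ h), ?_⟩
  rw [dist_eq_norm]
  refine (ContinuousLinearMap.opNorm_le_bound _ (half_pos hε).le fun ψ => ?_).trans_lt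
    (half_lt_self hε)
  change ‖toL2 μ (kernelFun μ h ψ) - toL2 μ (kernelFun μ h (rangeProj (spanIsometry t) ψ))‖ ≤ _
  rw [← map_sub]
  refine (norm_toL2_le μ _).trans ((ContinuousMap.norm_le _ (by positivity)).2 fun x => ?_)
  change ‖kernelFun μ h ψ x - kernelFun μ h (rangeProj (spanIsometry t) ψ) x‖ ≤ _
  rw [kernelFun_apply, kernelFun_apply, ← ContinuousLinearMap.adjoint_inner_left,
    ← ContinuousLinearMap.star_eq_adjoint, star_rangeProj, ← inner_sub_left]
  exact (norm_inner_le_norm _ _).trans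
    (mul_le_mul_of_nonneg_right (ht _ ⟨x, rfl⟩).le (norm_nonneg _))

theorem kernelFun_pairConv_toL2 (f g : C(X × X, ℂ)) (φ : C(X, ℂ)) :
    kernelFun μ (pairConv μ f g) (toL2 μ φ) = kernelFun μ f (integralOp μ g (toL2 μ φ)) := by
  ext x
  rw [integralOp_apply, kernelFun_toL2_apply, kernelFun_toL2_apply]
  simp only [kernelFun_toL2_apply]
  have hF := ContinuousMap.integral_integral_swap μ
    (⟨fun p : X × X => f (p.2, x) * g (p.1, p.2) * φ p.1, by fun_prop⟩ : C(X × X, ℂ))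
  change ∫ z, ∫ y, f (y, x) * g (z, y) * φ z ∂μ ∂μ = ∫ y, ∫ z, f (y, x) * g (z, y) * φ z ∂μ ∂μ at hF
  change ∫ z, (∫ y, f (y, x) * g (z, y) ∂μ) * φ z ∂μ = _
  simp only [← integral_mul_const, ← integral_const_mul, ← mul_assoc]
  exact hF

theorem inner_toL2_integralOp (f : C(X × X, ℂ)) (φ ψ : C(X, ℂ)) :
    inner ℂ (toL2 μ φ) (integralOp μ f (toL2 μ ψ)) =
      ∫ x, ∫ y, f (y, x) * ψ y * star (φ x) ∂μ ∂μ := by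
  rw [integralOp_apply, ContinuousMap.inner_toLp]
  simp only [kernelFun_toL2_apply, ← integral_mul_const]
  rfl

section Regular

variable [T2Space X] [μ.Regular]

theorem denseRange_toL2 : DenseRange (toL2 μ) :=
  ContinuousMap.toLp_denseRange ℂ μ ℂ (by norm_num)

theorem integralOp_pairConv (f g : C(X × X, ℂ)) :
    integralOp μ (pairConv μ f g) = integralOp μ f * integralOp μ g := by
  have h : ⇑(integralOp μ (pairConv μ f g)) = ⇑(integralOp μ f * integralOp μ g) :=
    (denseRange_toL2 μ).equalizer (ContinuousLinearMap.continuous _)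
      (ContinuousLinearMap.continuous _) (funext fun φ =>
        congrArg (toL2 μ) (kernelFun_pairConv_toL2 μ f g φ))
  exact DFunLike.coe_injective h

theorem integralOp_pairStar (f : C(X × X, ℂ)) :
    integralOp μ (pairStar f) = star (integralOp μ f) := by
  rw [ContinuousLinearMap.star_eq_adjoint, ContinuousLinearMap.eq_adjoint_iff]
  intro φ ψ
  refine (denseRange_toL2 μ).induction_on₂ (p := fun φ ψ =>
    inner ℂ (integralOp μ (pairStar f) φ) ψ = inner ℂ φ (integralOp μ f ψ)) ?_ ?_ φ ψ
  · exact isClosed_eq (by fun_prop) (by fun_prop)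
  · intro φ ψ
    -- On continuous functions both sides are double integrals that differ by the order of
    -- integration.
    rw [← inner_conj_symm, inner_toL2_integralOp, inner_toL2_integralOp, ← integral_conj]
    simp only [← integral_conj]
    have hF := ContinuousMap.integral_integral_swap μ
      (⟨fun p : X × X => f (p.1, p.2) * ψ p.1 * star (φ p.2), by fun_prop⟩ : C(X × X, ℂ))
    refine Eq.trans ?_ hF
    refine integral_congr_ae (Filter.Eventually.of_forall fun x => ?_)
    refine integral_congr_ae (Filter.Eventually.of_forall fun y => ?_)
    change (starRingEnd ℂ) (star (f (x, y)) * φ y * star (ψ x)) = f (x, y) * ψ x * star (φ y)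
    simp
    ring

end Regular

end IntegralOperator

/-- If `b < a`, then `a ^ 2 ≤ C * (b / a) ^ m` along `m = 2 ^ (n + 1) - 2`, whose right side tends
to zero. This replaces taking roots in the spectral radius argument. -/
theorem le_of_forall_pow_two_pow_le {a b C : ℝ} (ha : 0 ≤ a) (hb : 0 ≤ b)
    (h : ∀ n : ℕ, a ^ (2 ^ (n + 1)) ≤ C * b ^ (2 ^ (n + 1) - 2)) : a ≤ b := by
  by_contra! hab
  have ha' : 0 < a := hb.trans_lt hab
  have hlim : Filter.Tendsto (fun n : ℕ => C * (b / a) ^ n) Filter.atTop (nhds (C * 0)) :=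
    (tendsto_pow_atTop_nhds_zero_of_lt_one (div_nonneg hb ha)
      ((div_lt_one ha').2 hab)).const_mul C
  rw [mul_zero] at hlim
  have hsub : Filter.Tendsto (fun n : ℕ => 2 ^ (n + 1) - 2) Filter.atTop Filter.atTop := by
    refine Filter.tendsto_atTop_mono (fun n => ?_) (Filter.tendsto_sub_atTop_nat 2)
    have := Nat.lt_two_pow_self (n := n)
    have h2 : 2 ^ (n + 1) = 2 * 2 ^ n := pow_succ' 2 n
    change n - 2 ≤ 2 ^ (n + 1) - 2
    omega
  obtain ⟨n, hn⟩ := ((hlim.comp hsub).eventually_lt_const (pow_pos ha' 2)).exists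
  have h1 := h n
  have h2 : 2 ^ (n + 1) - 2 + 2 = 2 ^ (n + 1) :=
    Nat.sub_add_cancel (by simpa using Nat.pow_le_pow_right two_pos (Nat.le_add_left 1 n))
  change C * (b / a) ^ (2 ^ (n + 1) - 2) < a ^ 2 at hn
  generalize 2 ^ (n + 1) - 2 = m at hn h1 h2
  rw [← h2, pow_add] at h1
  rw [div_pow, mul_div_assoc', div_lt_iff₀ (pow_pos ha' m)] at hn
  linarith

section Hilbert

variable {H : Type u} [NormedAddCommGroup H] [InnerProductSpace ℂ H]

theorem norm_star_mul_self_clm [CompleteSpace H] (T : H →L[ℂ] H) :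
    ‖star T * T‖ = ‖T‖ * ‖T‖ :=
  CStarRing.norm_star_mul_self

theorem continuous_rankOne :
    Continuous fun p : H × H => InnerProductSpace.rankOne ℂ p.1 p.2 :=
  ((ContinuousLinearMap.smulRightL ℂ H H).continuous.comp
    ((innerSL ℂ).continuous.comp continuous_snd)).clm_apply continuous_fst

end Hilbert

/-! ### The C⋆-algebra of the pair groupoid -/

section PairGroupoid

variable {X : Type u} [TopologicalSpace X] [CompactSpace X] [MeasurableSpace X] [BorelSpace X]
  (μ : Measure X) [IsProbabilityMeasure μ]

theorem integral_norm_left_le_norm (f : C(X × X, ℂ)) (x : X) : ∫ y, ‖f (x, y)‖ ∂μ ≤ ‖f‖ := by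
  have h := integral_mono (μ := μ)
    (ContinuousMap.integrable μ (⟨fun y => ‖f (x, y)‖, by fun_prop⟩ : C(X, ℝ)))
    (integrable_const ‖f‖) fun y => f.norm_coe_le_norm (x, y)
  simpa using h

theorem integral_norm_right_le_norm (f : C(X × X, ℂ)) (x : X) : ∫ y, ‖f (y, x)‖ ∂μ ≤ ‖f‖ := by
  have h := integral_mono (μ := μ)
    (ContinuousMap.integrable μ (⟨fun y => ‖f (y, x)‖, by fun_prop⟩ : C(X, ℝ)))
    (integrable_const ‖f‖) fun y => f.norm_coe_le_norm (y, x)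
  simpa using h

theorem pairINorm_le_norm (f : C(X × X, ℂ)) : pairINorm μ f ≤ ‖f‖ :=
  max_le (Real.iSup_le (integral_norm_left_le_norm μ f) (norm_nonneg _))
    (Real.iSup_le (integral_norm_right_le_norm μ f) (norm_nonneg _))

theorem integral_norm_left_le_pairINorm (f : C(X × X, ℂ)) (x : X) :
    ∫ y, ‖f (x, y)‖ ∂μ ≤ pairINorm μ f :=
  le_max_of_le_left (le_ciSup (f := fun x => ∫ y, ‖f (x, y)‖ ∂μ)
    ⟨‖f‖, by rintro _ ⟨z, rfl⟩; exact integral_norm_left_le_norm μ f z⟩ x)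

theorem integral_norm_right_le_pairINorm (f : C(X × X, ℂ)) (x : X) :
    ∫ y, ‖f (y, x)‖ ∂μ ≤ pairINorm μ f :=
  le_max_of_le_right (le_ciSup (f := fun x => ∫ y, ‖f (y, x)‖ ∂μ)
    ⟨‖f‖, by rintro _ ⟨z, rfl⟩; exact integral_norm_right_le_norm μ f z⟩ x)

theorem norm_sq_toL2 (φ : C(X, ℂ)) : ‖toL2 μ φ‖ ^ 2 = ∫ x, ‖φ x‖ ^ 2 ∂μ := by
  have h := ContinuousMap.inner_toLp (𝕜 := ℂ) μ φ φ
  rw [inner_self_eq_norm_sq_to_K] at h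
  simp only [RCLike.mul_conj] at h
  have h2 : ∫ x, ((‖φ x‖ : ℂ)) ^ 2 ∂μ = ((∫ x, ‖φ x‖ ^ 2 ∂μ : ℝ) : ℂ) := by
    rw [← integral_complex_ofReal]
    push_cast
    rfl
  refine Complex.ofReal_injective (Eq.trans ?_ (h.trans h2))
  push_cast
  rfl

/-- The Schur test: `|φ| * |ψ|` is at most half the sum of the squares. Integrating `|f|` first over
the variable absent from each square bounds it by the `I`-norm. -/
theorem norm_inner_toL2_integralOp_le (f : C(X × X, ℂ)) (φ ψ : C(X, ℂ)) :
    ‖inner ℂ (toL2 μ φ) (integralOp μ f (toL2 μ ψ))‖ ≤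
      pairINorm μ f / 2 * (‖toL2 μ φ‖ ^ 2 + ‖toL2 μ ψ‖ ^ 2) := by
  rw [inner_toL2_integralOp, norm_sq_toL2, norm_sq_toL2]
  set N := pairINorm μ f
  let A : C(X × X, ℝ) := ⟨fun p => ‖f (p.2, p.1)‖ * (‖φ p.1‖ ^ 2 / 2), by fun_prop⟩
  let B : C(X × X, ℝ) := ⟨fun p => ‖f (p.2, p.1)‖ * (‖ψ p.2‖ ^ 2 / 2), by fun_prop⟩
  have hA : ∫ x, ∫ y, A (x, y) ∂μ ∂μ ≤ ∫ x, N * (‖φ x‖ ^ 2 / 2) ∂μ := by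
    refine integral_mono
      (ContinuousMap.integrable μ ⟨_, ContinuousMap.continuous_integral_prod μ A⟩)
      (ContinuousMap.integrable μ (⟨fun x => N * (‖φ x‖ ^ 2 / 2), by fun_prop⟩ : C(X, ℝ)))
      fun x => ?_
    change ∫ y, ‖f (y, x)‖ * (‖φ x‖ ^ 2 / 2) ∂μ ≤ _
    rw [integral_mul_const]
    exact mul_le_mul_of_nonneg_right (integral_norm_right_le_pairINorm μ f x) (by positivity)
  have hB : ∫ x, ∫ y, B (x, y) ∂μ ∂μ ≤ ∫ y, N * (‖ψ y‖ ^ 2 / 2) ∂μ := by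
    rw [ContinuousMap.integral_integral_swap]
    refine integral_mono
      (ContinuousMap.integrable μ
        ⟨_, ContinuousMap.continuous_integral_prod μ (B.comp ContinuousMap.prodSwap)⟩)
      (ContinuousMap.integrable μ (⟨fun x => N * (‖ψ x‖ ^ 2 / 2), by fun_prop⟩ : C(X, ℝ)))
      fun y => ?_
    change ∫ x, ‖f (y, x)‖ * (‖ψ y‖ ^ 2 / 2) ∂μ ≤ _
    rw [integral_mul_const]
    exact mul_le_mul_of_nonneg_right (integral_norm_left_le_pairINorm μ f y) (by positivity)
  have hAB : ∫ x, ∫ y, (A + B) (x, y) ∂μ ∂μ =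
      ∫ x, ∫ y, A (x, y) ∂μ ∂μ + ∫ x, ∫ y, B (x, y) ∂μ ∂μ := by
    refine Eq.trans ?_ (integral_add
      (ContinuousMap.integrable μ ⟨_, ContinuousMap.continuous_integral_prod μ A⟩)
      (ContinuousMap.integrable μ ⟨_, ContinuousMap.continuous_integral_prod μ B⟩))
    refine integral_congr_ae (Filter.Eventually.of_forall fun x => ?_)
    exact integral_add (ContinuousMap.integrable μ (A.curry x))
      (ContinuousMap.integrable μ (B.curry x))
  have hle : ‖∫ x, ∫ y, f (y, x) * ψ y * star (φ x) ∂μ ∂μ‖ ≤ ∫ x, ∫ y, (A + B) (x, y) ∂μ ∂μ := by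
    refine norm_integral_le_of_norm_le
      (ContinuousMap.integrable μ ⟨_, ContinuousMap.continuous_integral_prod μ (A + B)⟩)
      (Filter.Eventually.of_forall fun x => ?_)
    refine norm_integral_le_of_norm_le (ContinuousMap.integrable μ ((A + B).curry x))
      (Filter.Eventually.of_forall fun y => ?_)
    change _ ≤ ‖f (y, x)‖ * (‖φ x‖ ^ 2 / 2) + ‖f (y, x)‖ * (‖ψ y‖ ^ 2 / 2)
    rw [norm_mul, norm_mul, norm_star]
    nlinarith [mul_nonneg (norm_nonneg (f (y, x))) (sq_nonneg (‖φ x‖ - ‖ψ y‖))]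
  rw [integral_const_mul, integral_div] at hA hB
  linarith

/-- Left convolution acts on each slice `g (z, ·)` as the integral operator of `f`, so slices of
convolution powers are iterates of that operator. -/
theorem curry_pairConv (f g : C(X × X, ℂ)) (z : X) :
    (pairConv μ f g).curry z = kernelFun μ f (toL2 μ (g.curry z)) := by
  ext x
  rw [kernelFun_toL2_apply]
  rfl

/-- The powers, with exponents shifted by one, in the convolution algebra. -/
noncomputable def convPow (g : C(X × X, ℂ)) : ℕ → C(X × X, ℂ)
  | 0 => g
  | n + 1 => pairConv μ g (convPow g n)

theorem norm_toL2_curry_convPow_le (g : C(X × X, ℂ)) (n : ℕ) (z : X) :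
    ‖toL2 μ ((convPow μ g n).curry z)‖ ≤ ‖integralOp μ g‖ ^ n * ‖g‖ := by
  induction n with
  | zero =>
    rw [pow_zero, one_mul]
    exact (norm_toL2_le μ _).trans (norm_curry_le g z)
  | succ n ih =>
    have h : toL2 μ ((convPow μ g (n + 1)).curry z) =
        integralOp μ g (toL2 μ ((convPow μ g n).curry z)) :=
      congrArg (toL2 μ) (curry_pairConv μ g _ z)
    rw [h, pow_succ', mul_assoc]
    exact (ContinuousLinearMap.le_opNorm _ _).trans
      (mul_le_mul_of_nonneg_left ih (norm_nonneg _))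

/-- `convPow μ g (n + 1)` has `n + 2` factors: the last one applied is bounded by Cauchy–Schwarz on
rows, the initial one through the `L²` norm of its slice, and the `n` between them by the operator
norm. -/
theorem norm_convPow_succ_le (g : C(X × X, ℂ)) (n : ℕ) :
    ‖convPow μ g (n + 1)‖ ≤ ‖g‖ ^ 2 * ‖integralOp μ g‖ ^ n := by
  refine (ContinuousMap.norm_le _ (by positivity)).2 ?_
  rintro ⟨z, x⟩
  have h : convPow μ g (n + 1) (z, x) = kernelFun μ g (toL2 μ ((convPow μ g n).curry z)) x :=
    DFunLike.congr_fun (curry_pairConv μ g (convPow μ g n) z) x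
  rw [h]
  refine (norm_kernelFun_apply_le μ g _ x).trans ?_
  have := mul_le_mul_of_nonneg_left (norm_toL2_curry_convPow_le μ g n z) (norm_nonneg g)
  linarith

variable {μ} in
theorem PairRep.rep_convPow (ρ : PairRep μ) (g : C(X × X, ℂ)) (n : ℕ) :
    ρ.rep (convPow μ g n) = ρ.rep g ^ (n + 1) := by
  induction n with
  | zero => simp [convPow]
  | succ n ih => rw [convPow, ρ.map_conv, ih, ← pow_succ']

variable {μ} in
-- For a self-adjoint element the norm of a `2 ^ k`-th power is the power of the norm, so it can be
-- read off from the growth of the convolution powers.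
theorem PairRep.norm_rep_le_of_isSelfAdjoint (ρ : PairRep μ) {g : C(X × X, ℂ)}
    (hg : IsSelfAdjoint (ρ.rep g)) : ‖ρ.rep g‖ ≤ ‖integralOp μ g‖ := by
  refine le_of_forall_pow_two_pow_le (C := ‖g‖ ^ 2) (norm_nonneg _) (norm_nonneg _) fun n => ?_
  rw [← hg.norm_pow_two_pow]
  -- One `+ 1` is the index shift of `convPow`, the other the successor in `norm_convPow_succ_le`.
  have h2 : 2 ^ (n + 1) - 2 + 1 + 1 = 2 ^ (n + 1) :=
    Nat.sub_add_cancel (by simpa using Nat.pow_le_pow_right two_pos (Nat.le_add_left 1 n))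
  rw [← h2, ← ρ.rep_convPow]
  refine (ρ.norm_le _).trans ((pairINorm_le_norm μ _).trans ?_)
  simpa using norm_convPow_succ_le μ g (2 ^ (n + 1) - 2)

theorem rankOne_toL2 (φ ψ : C(X, ℂ)) :
    InnerProductSpace.rankOne ℂ (toL2 μ φ) (toL2 μ ψ) =
      integralOp μ ⟨fun p => star (ψ p.1) * φ p.2, by fun_prop⟩ := by
  ext1 χ
  rw [InnerProductSpace.rankOne_apply, integralOp_apply, ← map_smul]
  congr 1
  ext x
  have h : star (kernelRow ⟨fun p : X × X => star (ψ p.1) * φ p.2, by fun_prop⟩ x) =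
      star (φ x) • ψ := by
    ext y
    change star (star (ψ y) * φ x) = star (φ x) * ψ y
    rw [star_mul, star_star]
  rw [kernelFun_apply, h, map_smul, inner_smul_left]
  change _ * φ x = _
  simp [mul_comm]

variable [T2Space X] [μ.Regular]

theorem norm_integralOp_le (f : C(X × X, ℂ)) : ‖integralOp μ f‖ ≤ pairINorm μ f := by
  have key : ∀ φ ψ : Lp ℂ 2 μ, ‖inner ℂ φ (integralOp μ f ψ)‖ ≤
      pairINorm μ f / 2 * (‖φ‖ ^ 2 + ‖ψ‖ ^ 2) := fun φ ψ =>
    (denseRange_toL2 μ).induction_on₂ (p := fun φ ψ => ‖inner ℂ φ (integralOp μ f ψ)‖ ≤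
      pairINorm μ f / 2 * (‖φ‖ ^ 2 + ‖ψ‖ ^ 2)) (isClosed_le (by fun_prop) (by fun_prop))
      (norm_inner_toL2_integralOp_le μ f) φ ψ
  have h0 : 0 ≤ pairINorm μ f :=
    le_max_of_le_left (Real.iSup_nonneg fun x => integral_nonneg fun y => norm_nonneg _)
  refine ContinuousLinearMap.opNorm_le_of_unit_norm h0 fun ψ hψ => ?_
  by_cases hz : integralOp μ f ψ = 0
  · rw [hz, norm_zero]
    exact h0
  have hz' : ‖integralOp μ f ψ‖ ≠ 0 := norm_ne_zero_iff.2 hz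
  -- Testing against the normalized image makes both vectors unit vectors, so that `N / 2 * (1 + 1)
  -- = N`.
  have h := key ((‖integralOp μ f ψ‖⁻¹ : ℂ) • integralOp μ f ψ) ψ
  rw [inner_smul_left, inner_self_eq_norm_sq_to_K, norm_smul, hψ] at h
  simp only [norm_mul, RCLike.norm_conj, norm_inv, norm_pow, RCLike.norm_ofReal, Complex.norm_real,
    abs_norm, norm_norm, inv_mul_cancel₀ hz'] at h
  have h2 : ‖integralOp μ f ψ‖⁻¹ * ‖integralOp μ f ψ‖ ^ 2 = ‖integralOp μ f ψ‖ := by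
    field_simp
  rw [h2] at h
  linarith

/-- The representation of the convolution algebra on `L²` by integral operators. -/
noncomputable def integralRep : PairRep μ where
  H := Lp ℂ 2 μ
  rep := integralOp μ
  map_conv := integralOp_pairConv μ
  map_star := integralOp_pairStar μ
  norm_le := norm_integralOp_le μ

variable {μ} in
/-- The integral operators give the largest norm among all bounded representations of the
convolution algebra. -/
theorem PairRep.norm_rep_le (ρ : PairRep μ) (f : C(X × X, ℂ)) :
    ‖ρ.rep f‖ ≤ ‖integralOp μ f‖ := by
  -- The C⋆-identity reduces to the self-adjoint case, in both representations.
  have h : ρ.rep (pairConv μ (pairStar f) f) = star (ρ.rep f) * ρ.rep f := by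
    rw [ρ.map_conv, ρ.map_star]
  have h1 := ρ.norm_rep_le_of_isSelfAdjoint (h ▸ IsSelfAdjoint.star_mul_self (ρ.rep f))
  rw [h, integralOp_pairConv, integralOp_pairStar, norm_star_mul_self_clm (ρ.rep f)] at h1
  rw [norm_star_mul_self_clm (integralOp μ f)] at h1
  exact (mul_self_le_mul_self_iff (norm_nonneg _) (norm_nonneg _)).2 h1

/-- Rank-one operators built from continuous functions have continuous kernels, and continuous
functions are dense in `L²`. -/
theorem exists_norm_sub_integralOp_lt {T : Lp ℂ 2 μ →L[ℂ] Lp ℂ 2 μ} (hT : IsCompactOperator T)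
    {ε : ℝ} (hε : 0 < ε) : ∃ f, ‖T - integralOp μ f‖ < ε := by
  have hmem : T ∈ (LinearMap.range (integralOp μ)).topologicalClosure := by
    refine hT.mem_of_rankOne_mem (Submodule.isClosed_topologicalClosure _) fun x y => ?_
    refine (denseRange_toL2 μ).induction_on₂ (p := fun x y =>
      InnerProductSpace.rankOne ℂ x y ∈ (LinearMap.range (integralOp μ)).topologicalClosure)
      ?_ ?_ x y
    · refine (Submodule.isClosed_topologicalClosure _).preimage ?_
      exact continuous_rankOne
    · intro φ ψ
      rw [rankOne_toL2]
      exact Submodule.le_topologicalClosure _ ⟨_, rfl⟩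
  obtain ⟨_, ⟨f, rfl⟩, h⟩ := Metric.mem_closure_iff.1 hmem ε hε
  exact ⟨f, by rwa [← dist_eq_norm]⟩

/-- The image of the convolution algebra in its universal representation. -/
def pairUniversalImages :
    NonUnitalStarSubalgebra ℂ (BlockOps fun ρ : PairRep μ => ρ.H) where
  carrier := Set.range (pairUniversalImage μ)
  add_mem' := by
    rintro _ _ ⟨f, rfl⟩ ⟨g, rfl⟩
    exact ⟨f + g, BlockOps.ext fun ρ => map_add ρ.rep f g⟩
  mul_mem' := by
    rintro _ _ ⟨f, rfl⟩ ⟨g, rfl⟩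
    exact ⟨pairConv μ f g, BlockOps.ext fun ρ => ρ.map_conv f g⟩
  zero_mem' := ⟨0, BlockOps.ext fun ρ => map_zero ρ.rep⟩
  smul_mem' := by
    rintro c _ ⟨f, rfl⟩
    exact ⟨c • f, BlockOps.ext fun ρ => map_smul ρ.rep c f⟩
  star_mem' := by
    rintro _ ⟨f, rfl⟩
    exact ⟨pairStar f, BlockOps.ext fun ρ => ρ.map_star f⟩

/-- The C⋆-algebra of the pair groupoid is the algebra of compact operators. -/
theorem PairGroupoidCStar.exists_starAlgEquiv :
    ∃ Θ : PairGroupoidCStar μ ≃⋆ₐ[ℂ] CompactOps (Lp ℂ 2 μ),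
      ∀ f, (Θ (PairGroupoidCStar.of μ f) : Lp ℂ 2 μ →L[ℂ] Lp ℂ 2 μ) = integralOp μ f := by
  obtain ⟨e, he⟩ := exists_starAlgEquiv_generatedCStar (pairUniversalImages μ)
    (BlockOps.eval (fun ρ : PairRep μ => ρ.H) (integralRep μ)) (CompactOps (Lp ℂ 2 μ))
    isClosed_setOfPred_isCompactOperator
    (by
      rintro _ ⟨f, rfl⟩
      exact BlockOps.norm_le (norm_nonneg _) fun ρ => ρ.norm_rep_le f)
    (by
      rintro _ ⟨f, rfl⟩
      exact isCompactOperator_integralOp μ f)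
    (by
      intro T hT ε hε
      obtain ⟨f, hf⟩ := exists_norm_sub_integralOp_lt μ hT hε
      exact ⟨_, ⟨f, rfl⟩, hf⟩)
  exact ⟨e, fun f => he _⟩

end PairGroupoid

/-! ### Compact operators on a direct system of Hilbert spaces -/

section IsometricSystem

variable {I : Type u} [Preorder I] {F : I → Type v} [∀ i, NormedAddCommGroup (F i)]
  [∀ i, InnerProductSpace ℂ (F i)] [∀ i, CompleteSpace (F i)]
  (V : ∀ ⦃i j : I⦄, i ≤ j → F i →ₗᵢ[ℂ] F j)
  -- The universe is that of the Hilbert spaces in `SystemRep`, so that `K` carries one of the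
  -- representations defining the limit.
  {K : Type (max u v)} [NormedAddCommGroup K] [InnerProductSpace ℂ K] [CompleteSpace K]
  (U : ∀ i, F i →ₗᵢ[ℂ] K)

theorem CompactOps.conj_conj (hUV : ∀ ⦃i j : I⦄ (h : i ≤ j) (x : F i), U j (V h x) = U i x)
    {i j : I} (h : i ≤ j) (b : CompactOps (F i)) :
    CompactOps.conj (U j) (CompactOps.conj (V h) b) = CompactOps.conj (U i) b := by
  have hcomp : (U j).toContinuousLinearMap ∘L (V h).toContinuousLinearMap =
      (U i).toContinuousLinearMap := ContinuousLinearMap.ext (hUV h)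
  refine Subtype.ext ?_
  change conjOp _ (conjOp _ b.1) = conjOp _ b.1
  unfold conjOp
  rw [← hcomp, ContinuousLinearMap.adjoint_comp]
  rfl

/-- The representation by conjugation of the system of the algebras of compact operators of a
direct system of Hilbert spaces and isometries. -/
noncomputable def conjRep (hUV : ∀ ⦃i j : I⦄ (h : i ≤ j) (x : F i), U j (V h x) = U i x) :
    SystemRep fun _ _ h => CompactOps.conj (V h) where
  H := K
  rep i := (NonUnitalStarSubalgebraClass.subtype (CompactOps K)).comp (CompactOps.conj (U i))
  compatible _ _ h b := congrArg Subtype.val (CompactOps.conj_conj V U hUV h b)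

/-- The direct limit of the algebras of compact operators of a direct system of Hilbert spaces and
isometries is the algebra of compact operators of the limit space. -/
theorem exists_starAlgEquiv_compactOps [IsDirectedOrder I] [Nonempty I]
    (hUV : ∀ ⦃i j : I⦄ (h : i ≤ j) (x : F i), U j (V h x) = U i x)
    (hd : ∀ y, ∀ ε > 0, ∃ i x, ‖y - U i x‖ < ε) :
    ∃ Ψ : CStarDirectLimit (fun _ _ h => CompactOps.conj (V h)) ≃⋆ₐ[ℂ] CompactOps K,
      ∀ (i : I) (b : CompactOps (F i)),
        Ψ (CStarDirectLimit.of (fun _ _ h => CompactOps.conj (V h)) i b) =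
          CompactOps.conj (U i) b := by
  obtain ⟨Ψ, hΨ⟩ := CStarDirectLimit.exists_starAlgEquiv _ (conjRep V U hUV)
    (CompactOps K) isClosed_setOfPred_isCompactOperator
    (fun i b => norm_le_norm_conjOp (U i) b.1)
    (fun i b => (CompactOps.conj (U i) b).2)
    (fun T hT ε hε => exists_norm_sub_conj_lt U
      (fun i j h χ => ⟨V h χ, hUV h χ⟩) hd hT hε)
  exact ⟨Ψ, fun i b => Subtype.ext (hΨ i b)⟩

end IsometricSystem

/-! ### The isomorphisms for the inverse limit -/

namespace MeasInvSystem

variable {I : Type u} [Preorder I] (S : MeasInvSystem.{u, v} I) {μ : Measure S.Limit}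
  (hμ : ∀ i, MeasurePreserving (S.proj i) μ (S.μ i))

/-- The isometry `ψ ↦ ψ ∘ R` into the `L²` space of the inverse limit. -/
noncomputable def limitIsometry (i : I) : Lp ℂ 2 (S.μ i) →ₗᵢ[ℂ] Lp ℂ 2 μ :=
  Lp.compMeasurePreservingₗᵢ ℂ (S.proj i) (hμ i)

theorem limitIsometry_isometry {i j : I} (h : i ≤ j) (ψ : Lp ℂ 2 (S.μ i)) :
    S.limitIsometry hμ j (S.isometry h ψ) = S.limitIsometry hμ i ψ := by
  refine Lp.ext ?_
  have h1 : (S.limitIsometry hμ j (S.isometry h ψ) : S.Limit → ℂ) =ᵐ[μ] _ :=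
    Lp.coeFn_compMeasurePreserving (S.isometry h ψ) (hμ j)
  have h2 : (S.isometry h ψ : S.X j → ℂ) =ᵐ[S.μ j] _ :=
    Lp.coeFn_compMeasurePreserving ψ (S.measurePreserving_R h)
  have h3 : (S.limitIsometry hμ i ψ : S.Limit → ℂ) =ᵐ[μ] _ :=
    Lp.coeFn_compMeasurePreserving ψ (hμ i)
  refine h1.trans (((hμ j).quasiMeasurePreserving.ae_eq_comp h2).trans (Filter.EventuallyEq.trans
    (Filter.Eventually.of_forall fun a => ?_) h3.symm))
  change ψ (S.R h (S.proj j a)) = ψ (S.proj i a)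
  rw [S.R_proj]

variable [IsDirectedOrder I] [Nonempty I] [∀ i, IsProbabilityMeasure (S.μ i)] [μ.Regular]

/-- Continuous functions are dense in `L²`, cylinder functions are uniformly dense among them, and
for a probability measure the sup norm dominates the `L²` norm. -/
theorem exists_norm_sub_limitIsometry_lt (ψ : Lp ℂ 2 μ) {ε : ℝ} (hε : 0 < ε) :
    ∃ i χ, ‖ψ - S.limitIsometry hμ i χ‖ < ε := by
  have := S.isProbabilityMeasure_limit hμ
  obtain ⟨F, hF⟩ := (denseRange_toL2 μ).exists_dist_lt ψ (half_pos hε)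
  obtain ⟨i, f, hf⟩ := S.exists_pullback_near ℂ F (half_pos hε)
  refine ⟨i, toL2 (S.μ i) f, ?_⟩
  have h : S.limitIsometry hμ i (toL2 (S.μ i) f) = toL2 μ (S.pullback ℂ i f) := by
    refine Lp.ext ?_
    have h1 : (S.limitIsometry hμ i (toL2 (S.μ i) f) : S.Limit → ℂ) =ᵐ[μ] _ :=
      Lp.coeFn_compMeasurePreserving (toL2 (S.μ i) f) (hμ i)
    exact h1.trans (((hμ i).quasiMeasurePreserving.ae_eq_comp
      (ContinuousMap.coeFn_toLp (S.μ i) f)).trans (ContinuousMap.coeFn_toLp μ (S.pullback ℂ i f)).symm)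
  have h2 := norm_toL2_le μ (F - S.pullback ℂ i f)
  rw [map_sub] at h2
  rw [dist_eq_norm] at hF
  rw [h]
  linarith [norm_sub_le_norm_sub_add_norm_sub ψ (toL2 μ F) (toL2 μ (S.pullback ℂ i f))]

/-- The limit observable algebra is the algebra of compact operators on the `L²` space of the
inverse limit. -/
theorem exists_starAlgEquiv_limitObs :
    ∃ Ψ : S.LimitObs ≃⋆ₐ[ℂ] CompactOps (Lp ℂ 2 μ), ∀ (i : I) (b : S.Obs i),
      Ψ (CStarDirectLimit.of S.connect i b) = CompactOps.conj (S.limitIsometry hμ i) b := by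
  exact exists_starAlgEquiv_compactOps S.isometry (S.limitIsometry hμ)
    (fun _ _ => S.limitIsometry_isometry hμ)
    fun ψ ε hε => S.exists_norm_sub_limitIsometry_lt hμ ψ hε

set_option maxHeartbeats 1000000 in
/-- The C⋆-algebra of the pair groupoid of the inverse limit, the limit observable algebra and the
algebra of compact operators on the `L²` space of the inverse limit are isomorphic. -/
theorem exists_limit_isomorphisms :
    ∃ (Φ : PairGroupoidCStar μ ≃⋆ₐ[ℂ] S.LimitObs)
      (Ψ : S.LimitObs ≃⋆ₐ[ℂ] CompactOps (Lp ℂ 2 μ)),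
      (∀ (h : C(S.Limit × S.Limit, ℂ)) (ψ : Lp ℂ 2 μ),
        ((Ψ (Φ (PairGroupoidCStar.of μ h))).1 ψ : S.Limit → ℂ) =ᵐ[μ]
          fun x => ∫ y, h (y, x) * ψ y ∂μ) ∧
      ∀ (i : I) (b : S.Obs i), Ψ (CStarDirectLimit.of S.connect i b) =
        CompactOps.conj (S.limitIsometry hμ i) b := by
  have := S.isProbabilityMeasure_limit hμ
  obtain ⟨Ψ, hΨ⟩ := S.exists_starAlgEquiv_limitObs hμ
  obtain ⟨Θ, hΘ⟩ := PairGroupoidCStar.exists_starAlgEquiv μ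
  -- With this choice the composite of the two maps is `Θ`, which sends kernels to their integral
  -- operators.
  refine ⟨Θ.trans Ψ.symm, Ψ, fun h ψ => ?_, hΨ⟩
  have h1 : Ψ ((Θ.trans Ψ.symm) (PairGroupoidCStar.of μ h)) = Θ (PairGroupoidCStar.of μ h) :=
    Ψ.apply_symm_apply _
  rw [h1, hΘ]
  exact integralOp_apply_ae μ h ψ

end MeasInvSystem

/-! ### Haar measures on configurations and gauge orbits -/

namespace LatticeGraph

variable {G : Type v} [Group G] [TopologicalSpace G] [IsTopologicalGroup G] [CompactSpace G]
  {Λ : LatticeGraph.{u}}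

instance : IsProbabilityMeasure (redHaar G Λ) :=
  Measure.isProbabilityMeasure_map continuous_toRed.aemeasurable

instance : (redHaar G Λ).IsOpenPosMeasure :=
  continuous_toRed.isOpenPosMeasure_map Quotient.mk_surjective

instance [T2Space G] : (haar G Λ).Regular := by
  unfold haar
  infer_instance

instance [T2Space G] : (redHaar G Λ).Regular :=
  Measure.Regular.map_of_continuous (haar G Λ) continuous_toRed

end LatticeGraph

set_option maxHeartbeats 1000000 in
theorem mainTheorem1 {I : Type u} [Preorder I] [IsDirectedOrder I] [Nonempty I]
    (G : Type v) [Group G] [TopologicalSpace G] [IsTopologicalGroup G] [CompactSpace G] [T2Space G]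
    (Λ : I ⥤ LatticeGraph.{w}) (S : MeasInvSystem.{u, max v w} I)
    (hS : S = LatticeGraph.configSystem G Λ ∨ S = LatticeGraph.reducedSystem G Λ) :
    ∃ (μ : Measure S.Limit) (_ : μ.Regular)
      (hμ : ∀ i, MeasurePreserving (S.proj i) μ (S.μ i)),
      (∀ ν : Measure S.Limit, ν.Regular →
        (∀ i, MeasurePreserving (S.proj i) ν (S.μ i)) → ν = μ) ∧
      μ.IsOpenPosMeasure ∧
      ∃ (Φ : PairGroupoidCStar μ ≃⋆ₐ[ℂ] S.LimitObs)
        (Ψ : S.LimitObs ≃⋆ₐ[ℂ] CompactOps (Lp ℂ 2 μ)),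
        (∀ (h : C(S.Limit × S.Limit, ℂ)) (ψ : Lp ℂ 2 μ),
          ((Ψ (Φ (PairGroupoidCStar.of μ h))).1 ψ : S.Limit → ℂ) =ᵐ[μ]
            fun x => ∫ y, h (y, x) * ψ y ∂μ) ∧
        ∀ (i : I) (b : S.Obs i), Ψ (CStarDirectLimit.of S.connect i b) =
          CompactOps.conj (Lp.compMeasurePreservingₗᵢ ℂ (S.proj i) (hμ i)) b := by
  -- Only these three properties distinguish the two lattice systems from a general `MeasInvSystem`;
  -- the rest is uniform in `S`.
  have hμ : (∀ i, IsProbabilityMeasure (S.μ i)) ∧ (∀ i, (S.μ i).Regular) ∧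
      ∀ i, (S.μ i).IsOpenPosMeasure := by
    obtain rfl | rfl := hS
    · exact ⟨fun i => inferInstanceAs (IsProbabilityMeasure (LatticeGraph.haar G (Λ.obj i))),
        fun i => inferInstanceAs (LatticeGraph.haar G (Λ.obj i)).Regular,
        fun i => inferInstanceAs (LatticeGraph.haar G (Λ.obj i)).IsOpenPosMeasure⟩
    · exact ⟨fun i => inferInstanceAs (IsProbabilityMeasure (LatticeGraph.redHaar G (Λ.obj i))),
        fun i => inferInstanceAs (LatticeGraph.redHaar G (Λ.obj i)).Regular,
        fun i => inferInstanceAs (LatticeGraph.redHaar G (Λ.obj i)).IsOpenPosMeasure⟩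
  obtain ⟨_, _, _⟩ := hμ
  -- A space carrying a probability measure is non-empty.
  have (i : I) : Nonempty (S.X i) := (inferInstance : (ae (S.μ i)).NeBot).nonempty
  obtain ⟨μ, hreg, -, hμ⟩ := S.exists_limit_measure
  exact ⟨μ, hreg, hμ, fun ν hν hν' => S.limit_measure_unique hμ hν',
    S.isOpenPosMeasure_limit hμ, S.exists_limit_isomorphisms hμ⟩
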